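/- **Setting.** Let $p\in\mathbb N$ and $[p]=\{1,\dots,p\}$. A *graph* is a pair $([p],E)$ with $E\subset\{(a,b)\in[p]\times[p]: a\ne b\}$. An edge $(a,b)\in E$ is an *arrow* $a\to b$ if $(b,a)\notin E$ and a *line* if $(b,a)\in E$; $a,b$ are *adjacent* if $(a,b)\in E$ or $(b,a)\in E$. A *digraph* is a graph all of whose edges are arrows; a *DAG* is a digraph without directed cycles. The *skeleton* of a graph is obtained by replacing all edges by lines; $\mathrm{pa}_D(a)$ is the set of all $b$ with $b\to a$ in $D$. Write $a\preceq_G b$ if $a=b$ or there is a path $a=a_0,\dots,a_k=b$ with $(a_{i-1},a_i)\in E$ for all $i$. The classes of the equivalence relation "$a\preceq_G b$ and $b\preceq_G a$" are the *chain components* of $G$. For $i\in[p]$ let $(\mathcal X_i,\mathcal A_i,\mu_i)$ be a $\sigma$-finite measure space (for instance with $\mathcal X_i\subset\mathbb R$) containing two disjoint measurable sets of positive measure, and let $\mu=\bigotimes_i\mu_i$ on $\mathcal X=\prod_i\mathcal X_i$. All identities between densities are understood $\mu$-almost everywhere. For a DAG $D$ let $\mathcal M(D)$ be the set of strictly positive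 probability densities $f$ with respect to $\mu$ such that $f(x)=\prod_{i=1}^p f(x_i\mid x_{\mathrm{pa}_D(i)})$. For $I\subset[p]$, let $D^{(I)}$ be the DAG obtained from $D$ by deleting all arrows $a\to b$ with $b\in I$. Let $\mathcal I$ be a finite family of subsets of $[p]$ (*targets*) which is *conservative*: for every $a\in[p]$ some $I\in\mathcal I$ does not contain $a$. Let $\mathcal M_{\mathcal I}(D)$ be the set of tuples $(f^{(I)})_{I\in\mathcal I}$ with $f^{(I)}\in\mathcal M(D^{(I)})$ for all $I\in\mathcal I$ and $f^{(I)}(x_a\mid x_{\mathrm{pa}_D(a)})=f^{(J)}(x_a\mid x_{\mathrm{pa}_D(a)})$ for all $I,J\in\mathcal I$ and $a\notin I\cup J$. Two DAGs $D_1,D_2$ are *$\mathcal I$-Markov equivalent* if $\mathcal M_{\mathcal I}(D_1)=\mathcal M_{\mathcal I}(D_2)$; $[D]_{\mathcal I}$ denotes the equivalence class of $D$. The *$\mathcal I$-essential graph* of a DAG $D$ is $\mathcal E_{\mathcal I}(D)=\bigcup_{D'\in[D]_{\mathcal I}}D'$ (union of edge sets). An ordering $(v_1,\dots,v_n)$ of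 the vertices of a graph is a *perfect elimination ordering* if for every $i$ the vertices among $v_1,\dots,v_{i-1}$ adjacent to $v_i$ are pairwise adjacent. A digraph $D'$ *is obtained by orienting the edges of every chain component of a graph $G$ according to a perfect elimination ordering* if every edge of $D'$ is an edge of $G$, $D'$ and $G$ have the same skeleton, and for each chain component $T$ of $G$ there is a perfect elimination ordering of the induced subgraph $G[T]$ such that all arrows of $D'[T]$ point from earlier to later vertices. **Proposition.** (i) Let $D$ be a DAG and $D'$ a digraph on $[p]$. Then $D'$ is acyclic and $\mathcal I$-Markov equivalent to $D$ if and only if $D'$ is obtained by orienting the edges of every chain component of $\mathcal E_{\mathcal I}(D)$ according to a perfect elimination ordering. (ii) Consequently, $\mathcal I$-essential graphs are in one-to-one correspondence with $\mathcal I$-Markov equivalence classes: the map $[D]_{\mathcal I}\mapsto\mathcal E_{\mathcal I}(D)$ is a well-defined bijection from the set of $\mathcal I$-Markov equivalence classes of DAGs on $[p]$ onto the set of $\mathcal I$-essential graphs of DAGs on $[p]$. -/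

import Mathlib

open MeasureTheory
open scoped ENNReal

/-- A graph on the vertex set `V`: a set of ordered pairs of distinct vertices. -/
@[ext]
structure EGraph (V : Type*) where
  /-- `E a b` means that the ordered pair `(a, b)` is an edge. -/
  E : V → V → Prop
  irrefl : ∀ a, ¬ E a a

namespace EGraph

variable {V : Type*}

/-- `a ⟶ b`: the pair `(a, b)` is an edge, but `(b, a)` is not. -/
def Arrow (G : EGraph V) (a b : V) : Prop := G.E a b ∧ ¬ G.E b a

/-- Adjacency: at least one of `(a, b)`, `(b, a)` is an edge. -/
def Adj (G : EGraph V) (a b : V) : Prop := G.E a b ∨ G.E b a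

/-- A directed graph (digraph): every edge is an arrow. -/
def IsDirected (G : EGraph V) : Prop := ∀ a b, G.E a b → ¬ G.E b a

/-- A directed acyclic graph: a digraph without closed paths. -/
def IsDAG (G : EGraph V) : Prop := G.IsDirected ∧ ∀ a, ¬ Relation.TransGen G.E a a

/-- The subgraph relation for graphs with the same vertex set. -/
def IsSubgraph (G H : EGraph V) : Prop := ∀ a b, G.E a b → H.E a b

/-- The skeleton: forget all edge directions. -/
def skeleton (G : EGraph V) : EGraph V where
  E := G.Adj
  irrefl := fun a h => h.elim (G.irrefl a) (G.irrefl a)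

/-- The induced subgraph `G[T]`. -/
def induce (G : EGraph V) (T : Set V) : EGraph T where
  E := fun a b => G.E a b
  irrefl := fun a => G.irrefl a

/-- The union of a set of graphs on the same vertex set. -/
def union (C : Set (EGraph V)) : EGraph V where
  E := fun a b => ∃ G ∈ C, G.E a b
  irrefl := fun a ⟨G, _, h⟩ => G.irrefl a h

/-- The preorder `a ≼ b`: there is a path (possibly of length zero) from `a` to `b`. A path may
run through lines, and through arrows in their direction. -/
def Reach (G : EGraph V) (a b : V) : Prop := Relation.ReflTransGen G.E a b

/-- The chain components: the classes of the equivalence relation `a ≼ b ∧ b ≼ a`. -/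
def chainComponents (G : EGraph V) : Set (Set V) :=
  {T | ∃ a, T = {b | G.Reach a b ∧ G.Reach b a}}

open Classical in
/-- The parents of `a`. -/
noncomputable def parents [Fintype V] (G : EGraph V) (a : V) : Finset V :=
  Finset.univ.filter (fun b => G.Arrow b a)

/-- A set of pairwise adjacent vertices. -/
def IsClique (G : EGraph V) (C : Set V) : Prop := C.Pairwise G.Adj

/-- The ordering `σ = (v₁, …, vₙ)` of the vertices is a perfect elimination ordering of `G`: each
`vᵢ` is simplicial in the subgraph of the skeleton induced on `{v₁, …, vᵢ}`, that is, its neighbors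
in that set form a clique. -/
def IsPerfectElimination {n : ℕ} (G : EGraph V) (σ : Fin n ≃ V) : Prop :=
  ∀ i, G.IsClique {b | G.Adj (σ i) b ∧ ∃ j ≤ i, σ j = b}

/-- `D` is oriented according to `σ`, i.e. `σ` is a topological ordering of `D`. -/
def IsOrientedAccordingTo {n : ℕ} (D : EGraph V) (σ : Fin n ≃ V) : Prop :=
  ∀ a b, D.Reach a b → σ.symm a ≤ σ.symm b

/-- The digraph `D` is obtained from `G` by orienting the edges of every chain component of `G`
according to a perfect elimination ordering (of that component): `D` arises from `G` by choosing
one direction for every line and keeping every arrow, and the chosen directions inside each chain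
component follow a perfect elimination ordering. -/
def IsPerfectOrientationOf (D G : EGraph V) : Prop :=
  D.IsDirected ∧ D.IsSubgraph G ∧ D.skeleton = G.skeleton ∧
    ∀ T ∈ G.chainComponents, ∃ (n : ℕ) (σ : Fin n ≃ T),
      (G.induce T).IsPerfectElimination σ ∧ (D.induce T).IsOrientedAccordingTo σ

/-- The intervention graph `D^(I)`: delete all edges pointing into `I`. -/
def intervene (D : EGraph V) (I : Finset V) : EGraph V where
  E := fun a b => D.E a b ∧ b ∉ I
  irrefl := fun a h => D.irrefl a h.1

end EGraph

/-- A family of targets on `[p]` is conservative if every vertex is missed by some target. -/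
def IsConservative {p : ℕ} {ι : Type*} (𝓘 : ι → Finset (Fin p)) : Prop :=
  ∀ a, ∃ j, a ∉ 𝓘 j

section Densities

variable {p : ℕ} {X : Fin p → Type*} [∀ i, MeasurableSpace (X i)]

/-- The strictly positive probability densities with respect to the product of the `μ i`. -/
def posDensities (μ : ∀ i, Measure (X i)) : Set ((∀ i, X i) → ℝ≥0∞) :=
  {f | Measurable f ∧ (∀ x, 0 < f x ∧ f x < ∞) ∧ ∫⁻ x, f x ∂(Measure.pi μ) = 1}

/-- The marginal density `f(x_A)`: integrate out all coordinates outside `A`. It is written as a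
function of the full vector `x`, of which only the coordinates in `A` matter. -/
noncomputable def marginalDensity (μ : ∀ i, Measure (X i)) (f : (∀ i, X i) → ℝ≥0∞)
    (A : Finset (Fin p)) (x : ∀ i, X i) : ℝ≥0∞ :=
  lmarginal μ Aᶜ f x

/-- The conditional density `f(x_a | x_A) = f(x_a, x_A) / f(x_A)`. -/
noncomputable def condDensity (μ : ∀ i, Measure (X i)) (f : (∀ i, X i) → ℝ≥0∞)
    (a : Fin p) (A : Finset (Fin p)) (x : ∀ i, X i) : ℝ≥0∞ :=
  marginalDensity μ f (insert a A) x / marginalDensity μ f A x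

/-- `M(D)`: the positive densities obeying the Markov property of `D`, that is
`f(x) = ∏ᵢ f(xᵢ | x_pa(i))`. Identities between densities are meant almost everywhere. -/
def markovDensities (μ : ∀ i, Measure (X i)) (D : EGraph (Fin p)) :
    Set ((∀ i, X i) → ℝ≥0∞) :=
  {f | f ∈ posDensities μ ∧
    ∀ᵐ x ∂(Measure.pi μ), f x = ∏ i, condDensity μ f i (D.parents i) x}

/-- `M_𝓘(D)`: the tuples of densities, indexed by the family of targets `𝓘`, that are compatible
with the causal structure `D`. -/
def interventionDensities {ι : Type*} (μ : ∀ i, Measure (X i)) (𝓘 : ι → Finset (Fin p))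
    (D : EGraph (Fin p)) : Set (ι → (∀ i, X i) → ℝ≥0∞) :=
  {F | (∀ j, F j ∈ markovDensities μ (D.intervene (𝓘 j))) ∧
    ∀ j k, ∀ a ∉ 𝓘 j ∪ 𝓘 k, ∀ᵐ x ∂(Measure.pi μ),
      condDensity μ (F j) a (D.parents a) x = condDensity μ (F k) a (D.parents a) x}

/-- `𝓘`-Markov equivalence, for two DAGs `D₁`, `D₂`. -/
def MarkovEquivalent {ι : Type*} (μ : ∀ i, Measure (X i)) (𝓘 : ι → Finset (Fin p))
    (D₁ D₂ : EGraph (Fin p)) : Prop :=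
  interventionDensities μ 𝓘 D₁ = interventionDensities μ 𝓘 D₂

/-- The `𝓘`-Markov equivalence class of the DAG `D`. -/
def markovClass {ι : Type*} (μ : ∀ i, Measure (X i)) (𝓘 : ι → Finset (Fin p))
    (D : EGraph (Fin p)) : Set (EGraph (Fin p)) :=
  {D' | D'.IsDAG ∧ MarkovEquivalent μ 𝓘 D' D}

/-- The `𝓘`-essential graph of the DAG `D`: the union of all DAGs in its equivalence class. -/
def essentialGraph {ι : Type*} (μ : ∀ i, Measure (X i)) (𝓘 : ι → Finset (Fin p))
    (D : EGraph (Fin p)) : EGraph (Fin p) :=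
  EGraph.union (markovClass μ 𝓘 D)

/-- The set of all `𝓘`-Markov equivalence classes of DAGs. -/
def markovClasses {ι : Type*} (μ : ∀ i, Measure (X i)) (𝓘 : ι → Finset (Fin p)) :
    Set (Set (EGraph (Fin p))) :=
  {C | ∃ D : EGraph (Fin p), D.IsDAG ∧ C = markovClass μ 𝓘 D}

/-- The set of all `𝓘`-essential graphs of DAGs. -/
def essentialGraphs {ι : Type*} (μ : ∀ i, Measure (X i)) (𝓘 : ι → Finset (Fin p)) :
    Set (EGraph (Fin p)) :=
  {G | ∃ D : EGraph (Fin p), D.IsDAG ∧ G = essentialGraph μ 𝓘 D}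

end Densities

/-! The analytic equivalence reduces to a combinatorial one: two DAGs have the same interventional
model iff they share their skeleton and their forced edges (`markovEquivalent_iff_structEquiv`). If
they do, they are linked by reversals of covered edges that no target separates
(`StructEquiv.induction_flip`), and such a reversal only rewrites f(x|A) f(y|x,A) as f(y|A)
f(x|y,A). Conversely, a product density perturbed by a centered factor on {b} ∪ T, with T among the
parents of b, lies in the model. Any DAG with the same model must accommodate this dependence, which
exposes adjacencies, v-structures and the arrows separated by a target.

On the combinatorial side, the forced edges are closed under three of Meek's rules. The compelled
edges so obtained persist throughout the class. The crux is `Compelled.trans_line`: a compelled edge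
a → b and a line b – c yield a compelled edge a → c. Hence the line graph is chordal, no compelled
edge stays within a chain component, and orienting the lines without v-structures or cycles gives an
equivalent DAG. By Dirac's theorem on simplicial vertices a perfect elimination ordering can start
anywhere, so every line occurs in both directions. The essential graph therefore consists of the
compelled arrows and the lines, which gives (i); since (i) recovers the class from its essential
graph, (ii) follows. -/

namespace EGraph

variable {V ι : Type*}

/-! ### Acyclic digraphs, forced edges and structural equivalence -/

section Basic

variable {D : EGraph V}

theorem IsDAG.asymm (hD : D.IsDAG) {a b : V} (h : D.E a b) : ¬ D.E b a := hD.1 a b h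

theorem IsDAG.arrow_iff (hD : D.IsDAG) {a b : V} : D.Arrow a b ↔ D.E a b :=
  ⟨fun h => h.1, fun h => ⟨h, hD.asymm h⟩⟩

theorem isDAG_of_acyclic (h : ∀ a, ¬ Relation.TransGen D.E a a) : D.IsDAG :=
  ⟨fun a _ hab hba => h a ((Relation.TransGen.single hab).tail hba), h⟩

theorem E.ne {a b : V} (h : D.E a b) : a ≠ b := fun e => D.irrefl a (e ▸ h)

theorem Adj.symm {a b : V} (h : D.Adj a b) : D.Adj b a := Or.symm h

theorem Adj.ne {a b : V} (h : D.Adj a b) : a ≠ b :=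
  h.elim (fun h => E.ne h) fun h => (E.ne h).symm

theorem IsDAG.E_of_path (hD : D.IsDAG) {a b c : V} (hab : D.E a b) (hbc : D.E b c)
    (hac : D.Adj a c) : D.E a c :=
  hac.resolve_right fun h => hD.2 a (((Relation.TransGen.single hab).tail hbc).tail h)

/-- A finite acyclic digraph has a topological ordering. -/
theorem IsDAG.exists_rank [Finite V] (hD : D.IsDAG) :
    ∃ f : V → ℕ, Function.Injective f ∧ ∀ a b, D.E a b → f a < f b := by
  classical
  cases nonempty_fintype V
  let P : PartialOrder V :=
    { le := D.Reach
      le_refl := fun a => Relation.ReflTransGen.refl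
      le_trans := fun a b c => Relation.ReflTransGen.trans
      le_antisymm := fun a b hab hba => by
        rcases Relation.reflTransGen_iff_eq_or_transGen.1 hab with h | h
        · exact h.symm
        · exact (hD.2 a (h.trans_left hba)).elim }
  let : Fintype (LinearExtension V) := inferInstanceAs (Fintype V)
  let o := Fintype.orderIsoFinOfCardEq (LinearExtension V) rfl
  refine ⟨fun v => (o.symm (toLinearExtension v) : ℕ), ?_, ?_⟩
  · intro a b h
    exact o.symm.injective (Fin.ext h)
  · intro a b h
    have h1 : toLinearExtension a ≤ toLinearExtension b :=
      toLinearExtension.monotone (Relation.ReflTransGen.single h)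
    have h2 : o.symm (toLinearExtension a) ≤ o.symm (toLinearExtension b) := o.symm.monotone h1
    refine lt_of_le_of_ne h2 fun h3 => E.ne h ?_
    exact o.symm.injective (Fin.ext h3)

end Basic

/-- The edges `a ⟶ b` whose direction is visible locally: those that are part of a v-structure, and
those with precisely one end point in some target. -/
def Forced (𝓘 : ι → Finset V) (D : EGraph V) (a b : V) : Prop :=
  D.E a b ∧ ((∃ c, D.E c b ∧ a ≠ c ∧ ¬ D.Adj a c) ∨ ∃ j, ¬ (a ∈ 𝓘 j ↔ b ∈ 𝓘 j))

/-- Two digraphs with the same skeleton and the same forced edges. -/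
def StructEquiv (𝓘 : ι → Finset V) (D₁ D₂ : EGraph V) : Prop :=
  (∀ a b, D₁.Adj a b ↔ D₂.Adj a b) ∧ ∀ a b, Forced 𝓘 D₁ a b ↔ Forced 𝓘 D₂ a b

section StructEquiv

variable {𝓘 : ι → Finset V} {D D₁ D₂ D₃ : EGraph V}

theorem StructEquiv.refl (D : EGraph V) : StructEquiv 𝓘 D D :=
  ⟨fun _ _ => Iff.rfl, fun _ _ => Iff.rfl⟩

theorem StructEquiv.symm (h : StructEquiv 𝓘 D₁ D₂) : StructEquiv 𝓘 D₂ D₁ :=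
  ⟨fun a b => (h.1 a b).symm, fun a b => (h.2 a b).symm⟩

theorem StructEquiv.trans (h : StructEquiv 𝓘 D₁ D₂) (h' : StructEquiv 𝓘 D₂ D₃) :
    StructEquiv 𝓘 D₁ D₃ :=
  ⟨fun a b => (h.1 a b).trans (h'.1 a b), fun a b => (h.2 a b).trans (h'.2 a b)⟩

theorem forced_of_collider {a b c : V} (hab : D.E a b) (hcb : D.E c b) (hne : a ≠ c)
    (hac : ¬ D.Adj a c) : Forced 𝓘 D a b := ⟨hab, Or.inl ⟨c, hcb, hne, hac⟩⟩

end StructEquiv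

/-! ### Reversal of covered edges -/

section CoveredFlip

/-- Reverse the edge `x ⟶ y`. -/
def flip (D : EGraph V) (x y : V) (hxy : D.E x y) : EGraph V where
  E a b := (D.E a b ∧ ¬ (a = x ∧ b = y)) ∨ (a = y ∧ b = x)
  irrefl a h := by
    rcases h with h | ⟨rfl, h⟩
    · exact D.irrefl a h.1
    · exact E.ne hxy h.symm

/-- The edge `x ⟶ y` is covered: up to `x` itself, `x` and `y` have the same parents. -/
def IsCovered (D : EGraph V) (x y : V) : Prop := ∀ z, z ≠ x → (D.E z y ↔ D.E z x)

variable {𝓘 : ι → Finset V} {D D₁ D₂ : EGraph V} {x y : V}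

theorem IsDAG.flip (hD : D.IsDAG) (hxy : D.E x y) (hc : D.IsCovered x y) :
    (D.flip x y hxy).IsDAG := by
  let R : V → V → Prop := fun a b => D.E a b ∧ ¬ (a = x ∧ b = y)
  have hR : ∀ a b, R a b → D.E a b := fun a b h => h.1
  refine isDAG_of_acyclic fun a ha => ?_
  -- Cut a walk at its first and last use of y → x. A closed walk using it gives a path from x to y
  -- avoiding the edge x → y; its last step z → y has z ≠ x, so z → x by coveredness, closing a
  -- cycle in `D`.
  have key : ∀ u v, Relation.TransGen (D.flip x y hxy).E u v → Relation.TransGen R u v ∨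
      (Relation.ReflTransGen R u y ∧ Relation.ReflTransGen R x v) := by
    intro u v h
    induction h with
    | single h =>
      rcases h with h | ⟨rfl, rfl⟩
      · exact Or.inl (.single h)
      · exact Or.inr ⟨.refl, .refl⟩
    | tail _ h ih =>
      rcases h with h | ⟨rfl, rfl⟩
      · exact ih.imp (fun ih => ih.tail h) fun ih => ⟨ih.1, ih.2.tail h⟩
      · exact Or.inr ⟨ih.elim (fun ih => ih.to_reflTransGen) fun ih => ih.1, .refl⟩
  rcases key a a ha with h | ⟨h1, h2⟩
  · exact hD.2 a (Relation.TransGen.mono hR _ _ h)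
  · rcases Relation.ReflTransGen.cases_tail (h2.trans h1) with h | ⟨z, hz, hzy⟩
    · exact E.ne hxy h.symm
    · have hzx : z ≠ x := fun e => hzy.2 ⟨e, rfl⟩
      exact hD.2 x (Relation.TransGen.tail' (Relation.ReflTransGen.mono hR _ _ hz) ((hc z hzx).1 hzy.1))

theorem flip_adj (hxy : D.E x y) (a b : V) : (D.flip x y hxy).Adj a b ↔ D.Adj a b := by
  simp only [Adj, flip]
  constructor
  · rintro ((h | ⟨rfl, rfl⟩) | (h | ⟨rfl, rfl⟩)) <;> tauto
  · intro h
    by_cases h1 : a = x ∧ b = y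
    · tauto
    · by_cases h2 : a = y ∧ b = x
      · tauto
      · tauto

theorem flip_structEquiv (hxy : D.E x y) (hc : D.IsCovered x y)
    (hI : ∀ j, x ∈ 𝓘 j ↔ y ∈ 𝓘 j) : StructEquiv 𝓘 (D.flip x y hxy) D := by
  refine ⟨flip_adj hxy, fun a b => ⟨?_, ?_⟩⟩
  · rintro ⟨hab | ⟨rfl, rfl⟩, h⟩
    · refine ⟨hab.1, h.imp_left ?_⟩
      rintro ⟨c, hcb | ⟨rfl, rfl⟩, hac, hadj⟩
      · exact ⟨c, hcb.1, hac, fun h => hadj ((flip_adj hxy _ _).2 h)⟩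
      · exact (hadj ((flip_adj hxy _ _).2 (Or.inl ((hc a (E.ne hab.1)).2 hab.1)))).elim
    · exfalso
      rcases h with ⟨c, hcb | ⟨rfl, _⟩, hac, hadj⟩ | ⟨j, hj⟩
      · exact hadj ((flip_adj hxy _ _).2 (Or.inr ((hc c (E.ne hcb.1)).2 hcb.1)))
      · exact hac rfl
      · exact hj (hI j).symm
  · rintro ⟨hab, h⟩
    have hne : ¬ (a = x ∧ b = y) := by
      rintro ⟨rfl, rfl⟩
      rcases h with ⟨c, hcb, hac, hadj⟩ | ⟨j, hj⟩
      · exact hadj (Or.inr ((hc c hac.symm).1 hcb))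
      · exact hj (hI j)
    refine ⟨Or.inl ⟨hab, hne⟩, h.imp_left ?_⟩
    rintro ⟨c, hcb, hac, hadj⟩
    refine ⟨c, Or.inl ⟨hcb, ?_⟩, hac, fun h => hadj ((flip_adj hxy _ _).1 h)⟩
    rintro ⟨rfl, rfl⟩
    exact hadj (Or.inl ((hc a hac).1 hab))

/-- Of two different equivalent acyclic digraphs, the first has a covered edge that is reversed in
the second. -/
theorem StructEquiv.exists_covered [Finite V] (h : StructEquiv 𝓘 D₁ D₂) (h₁ : D₁.IsDAG)
    (h₂ : D₂.IsDAG) (hne : ∃ a b, D₁.E a b ∧ ¬ D₂.E a b) :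
    ∃ x y, D₁.E x y ∧ D₂.E y x ∧ D₁.IsCovered x y := by
  classical
  obtain ⟨f, hf, hlt⟩ := h₁.exists_rank
  have hlt' : ∀ {a b}, D₁.Adj a b → f a < f b → D₁.E a b := fun h h' =>
    h.resolve_right fun h => absurd (hlt _ _ h) (by omega)
  -- Take y as the earliest head of a reversed edge, and x as the latest tail of a reversed edge
  -- into y. Then edges with head before y, and edges into y with tail after x, agree in both
  -- digraphs.
  let B : Set V := {b | ∃ a, D₁.E a b ∧ ¬ D₂.E a b}
  obtain ⟨y, ⟨x₀, hx₀⟩, hymin⟩ := B.toFinite.exists_minimalFor f B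
    (let ⟨a, b, h⟩ := hne; ⟨b, a, h⟩)
  have hy : ∀ a b, D₁.E a b → f b < f y → D₂.E a b := by
    intro a b hab hb
    by_contra hn
    exact absurd (hymin (j := b) ⟨a, hab, hn⟩ hb.le) (by omega)
  let A : Set V := {a | D₁.E a y ∧ ¬ D₂.E a y}
  obtain ⟨x, ⟨hxy, hxy'⟩, hxmax⟩ := A.toFinite.exists_maximalFor f A ⟨x₀, hx₀⟩
  have hx : ∀ z, D₁.E z y → f x < f z → D₂.E z y := by
    intro z hz hb
    by_contra hn
    exact absurd (hxmax (j := z) ⟨hz, hn⟩ hb.le) (by omega)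
  have hyx : D₂.E y x := ((h.1 x y).1 (Or.inl hxy)).resolve_left hxy'
  refine ⟨x, y, hxy, hyx, fun z hzx => ⟨fun hzy => ?_, fun hz => ?_⟩⟩
  · by_cases hadj : D₁.Adj z x
    · refine hlt' hadj (lt_of_not_ge fun hge => ?_)
      have hxz : f x < f z := lt_of_le_of_ne hge fun e => hzx (hf e.symm)
      have h2 := hy x z (hlt' hadj.symm hxz) (hlt _ _ hzy)
      exact h₂.2 x (((Relation.TransGen.single h2).tail (hx z hzy hxz)).tail hyx)
    · exact (hxy' ((h.2 x y).1
        (forced_of_collider hxy hzy hzx.symm fun h => hadj h.symm)).1).elim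
  · by_cases hadj : D₁.Adj z y
    · exact h₁.E_of_path hz hxy hadj
    · have h2 := hy z x hz (hlt _ _ hxy)
      have hzy : y ≠ z := fun e => h₁.asymm hxy (e ▸ hz)
      have := (h.2 y x).2 (forced_of_collider hyx h2 hzy
        fun hh => hadj ((h.1 _ _).2 hh.symm))
      exact (h₁.asymm hxy this.1).elim

/-- Equivalent acyclic digraphs are connected by reversals of covered edges. -/
theorem StructEquiv.induction_flip [Finite V] {R : EGraph V → EGraph V → Prop}
    (hrefl : ∀ D, R D D) (htrans : ∀ D₁ D₂ D₃, R D₁ D₂ → R D₂ D₃ → R D₁ D₃)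
    (hflip : ∀ D x y (hxy : D.E x y), D.IsDAG → D.IsCovered x y → (∀ j, x ∈ 𝓘 j ↔ y ∈ 𝓘 j) →
      R D (D.flip x y hxy))
    (h : StructEquiv 𝓘 D₁ D₂) (h₁ : D₁.IsDAG) (h₂ : D₂.IsDAG) : R D₁ D₂ := by
  -- Each flip makes one more edge agree with `D₂`, so the number of disagreeing edges drops.
  let N : EGraph V → Set (V × V) := fun D => {q | D.E q.1 q.2 ∧ ¬ D₂.E q.1 q.2}
  induction hn : (N D₁).ncard using Nat.strong_induction_on generalizing D₁ with
  | _ n ih =>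
    by_cases hne : ∃ a b, D₁.E a b ∧ ¬ D₂.E a b
    · obtain ⟨x, y, hxy, hyx, hc⟩ := h.exists_covered h₁ h₂ hne
      have hI : ∀ j, x ∈ 𝓘 j ↔ y ∈ 𝓘 j := fun j => by
        by_contra hj
        exact h₂.asymm hyx ((h.2 x y).1 ⟨hxy, Or.inr ⟨j, hj⟩⟩).1
      refine htrans _ _ _ (hflip D₁ x y hxy h₁ hc hI)
        (ih _ ?_ ((flip_structEquiv hxy hc hI).trans h) (h₁.flip hxy hc) rfl)
      rw [← hn]
      refine Set.ncard_lt_ncard (Set.ssubset_iff_exists.2 ⟨?_, (x, y), ⟨hxy, h₂.asymm hyx⟩, ?_⟩)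
        (Set.toFinite _)
      · rintro ⟨a, b⟩ ⟨hab | ⟨rfl, rfl⟩, hab'⟩
        · exact ⟨hab.1, hab'⟩
        · exact (hab' hyx).elim
      · rintro ⟨hq | ⟨e, _⟩, _⟩
        · exact hq.2 ⟨rfl, rfl⟩
        · exact E.ne hxy e
    · push Not at hne
      have : D₁ = D₂ := by
        ext a b
        refine ⟨hne a b, fun hab => ((h.1 a b).2 (Or.inl hab)).resolve_right fun hba => ?_⟩
        exact h₂.asymm hab (hne _ _ hba)
      exact this ▸ hrefl _

end CoveredFlip

end EGraph

namespace EGraph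

variable {V ι : Type*}

/-! ### Compelled edges and lines -/

section Compelled

/-- The edges of `D` whose direction is determined by the forced edges through Meek's rules. -/
inductive Compelled (𝓘 : ι → Finset V) (D : EGraph V) : V → V → Prop
  | forced {a b : V} : Forced 𝓘 D a b → Compelled 𝓘 D a b
  | chain {a b c : V} : Compelled 𝓘 D a b → D.E b c → ¬ D.Adj a c → Compelled 𝓘 D b c
  | triangle {a b c : V} : Compelled 𝓘 D a b → Compelled 𝓘 D b c → D.E a c → Compelled 𝓘 D a c
  | kite {a b c d : V} : D.E a b → Compelled 𝓘 D c b → Compelled 𝓘 D d b → c ≠ d → ¬ D.Adj c d →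
      D.E a c → D.Adj a d → Compelled 𝓘 D a b

variable {𝓘 : ι → Finset V} {D D' : EGraph V} {a b c d e : V}

theorem Compelled.E (h : Compelled 𝓘 D a b) : D.E a b := by
  cases h with
  | forced h => exact h.1
  | chain _ h => exact h
  | triangle _ _ h => exact h
  | kite h => exact h

/-- Soundness of the rules: reversing the concluded edge in `D'` would create a directed cycle or a
v-structure, hence a forced edge, that `D` lacks. -/
theorem Compelled.E_of_structEquiv (hD : D.IsDAG) (hD' : D'.IsDAG) (h : StructEquiv 𝓘 D D')
    (hc : Compelled 𝓘 D a b) : D'.E a b := by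
  induction hc with
  | forced hf => exact ((h.2 _ _).1 hf).1
  | @chain a b c hab hbc hac ih =>
    refine ((h.1 b c).1 (Or.inl hbc)).resolve_right fun hcb => ?_
    have hne : a ≠ c := fun e => hD.asymm hab.E (e ▸ hbc)
    have hf := forced_of_collider (𝓘 := 𝓘) hcb ih hne.symm fun hh => hac ((h.1 _ _).2 hh.symm)
    exact hD.asymm hbc ((h.2 _ _).2 hf).1
  | triangle _ _ hac ih₁ ih₂ => exact hD'.E_of_path ih₁ ih₂ ((h.1 _ _).1 (Or.inl hac))
  | @kite a b c d hab _ _ hne hcd hac had ih₁ ih₂ =>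
    refine ((h.1 a b).1 (Or.inl hab)).resolve_right fun hba => ?_
    have hca : D'.E c a := hD'.E_of_path ih₁ hba ((h.1 _ _).1 (Or.inr hac))
    have hda : D'.E d a := hD'.E_of_path ih₂ hba ((h.1 _ _).1 had.symm)
    have hf := forced_of_collider (𝓘 := 𝓘) hca hda hne fun hh => hcd ((h.1 _ _).2 hh)
    exact hD.asymm hac ((h.2 _ _).2 hf).1

theorem not_transGen_compelled (hD : D.IsDAG) (a : V) :
    ¬ Relation.TransGen (Compelled 𝓘 D) a a := fun h =>
  hD.2 a (Relation.TransGen.mono (fun _ _ h => h.E) _ _ h)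

/-- Adjacent vertices whose edge is not compelled. -/
def Line (𝓘 : ι → Finset V) (D : EGraph V) (a b : V) : Prop :=
  D.Adj a b ∧ ¬ Compelled 𝓘 D a b ∧ ¬ Compelled 𝓘 D b a

theorem Line.symm (h : Line 𝓘 D a b) : Line 𝓘 D b a := ⟨h.1.symm, h.2.2, h.2.1⟩

theorem E.compelled_or_line (hD : D.IsDAG) {a b : V} (h : D.E a b) :
    Compelled 𝓘 D a b ∨ Line 𝓘 D a b := by
  by_cases hc : Compelled 𝓘 D a b
  · exact Or.inl hc
  · exact Or.inr ⟨Or.inl h, hc, fun h' => hD.asymm h h'.E⟩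

theorem Line.mem_iff {a b : V} (h : Line 𝓘 D a b) (j : ι) : a ∈ 𝓘 j ↔ b ∈ 𝓘 j := by
  by_contra hj
  rcases h.1 with hh | hh
  · exact h.2.1 (.forced ⟨hh, Or.inr ⟨j, hj⟩⟩)
  · exact h.2.2 (.forced ⟨hh, Or.inr ⟨j, fun e => hj e.symm⟩⟩)

theorem Compelled.of_not_adj (h : Compelled 𝓘 D a b) (hbc : D.Adj b c) (hne : a ≠ c)
    (hac : ¬ D.Adj a c) : Compelled 𝓘 D b c ∨ Compelled 𝓘 D c b := by
  rcases hbc with hbc | hcb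
  · exact Or.inl (.chain h hbc hac)
  · exact Or.inr (.forced (forced_of_collider hcb h.E hne.symm fun hh => hac hh.symm))

/-- If d → c and e → c both held, they would form a v-structure and be compelled. This rules out b →
c by acyclicity, and leaves c → d or c → e, as the kite rule needs. -/
theorem compelled_of_kite (hD : D.IsDAG) (hd : Compelled 𝓘 D d b) (he : Compelled 𝓘 D e b)
    (hne : d ≠ e) (hde : ¬ D.Adj d e) (hcd : D.Adj c d) (hce : D.Adj c e) (hcb : D.Adj c b)
    (hdc : ¬ Compelled 𝓘 D d c) : Compelled 𝓘 D c b := by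
  have hnot : ¬ (D.E d c ∧ D.E e c) := fun hh =>
    hdc (.forced (forced_of_collider hh.1 hh.2 hne hde))
  have hcb' : D.E c b := hcb.resolve_right fun hbc =>
    hnot ⟨hD.E_of_path hd.E hbc hcd.symm, hD.E_of_path he.E hbc hce.symm⟩
  rcases hcd with hcd' | hdc'
  · exact .kite hcb' hd he hne hde hcd' hce
  · exact .kite hcb' he hd hne.symm (fun hh => hde hh.symm)
      (hce.resolve_right fun hec => hnot ⟨hdc', hec⟩) (Or.inr hdc')

/-- A compelled edge into an end point of a line comes with a compelled edge into the other end
point. -/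
theorem Compelled.trans_line [Finite V] (hD : D.IsDAG) (hab : Compelled 𝓘 D a b)
    (hbc : Line 𝓘 D b c) : Compelled 𝓘 D a c := by
  obtain ⟨f, -, hlt⟩ := hD.exists_rank
  induction hn : f b using Nat.strong_induction_on generalizing a b c with
  | _ n ih =>
    subst hn
    have IH : ∀ {a b' c}, D.E b' b → Compelled 𝓘 D a b' → Line 𝓘 D b' c → Compelled 𝓘 D a c :=
      fun hb h1 h2 => ih _ (hlt _ _ hb) h1 h2 rfl
    have hcb : ¬ Compelled 𝓘 D c b := hbc.2.2
    -- a compelled edge into `b` starts at a neighbor of `c`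
    have hadj : ∀ {a}, Compelled 𝓘 D a b → D.Adj a c := fun {a} h => by
      by_contra hn
      have hne : a ≠ c := fun e => hcb (e ▸ h)
      exact (h.of_not_adj hbc.1 hne hn).elim hbc.2.1 hbc.2.2
    -- and is not preceded by a compelled edge from `c`
    have hnc : ∀ {a}, Compelled 𝓘 D a b → ¬ Compelled 𝓘 D c a := fun {a} h h' =>
      hcb (.triangle h' h (hD.E_of_path h'.E h.E hbc.1.symm))
    have hline : ∀ {a}, Compelled 𝓘 D a b → ¬ Compelled 𝓘 D a c → Line 𝓘 D a c := fun h h' =>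
      ⟨hadj h, h', hnc h⟩
    by_contra hac
    have hl := hline hab hac
    -- Otherwise a – c is a line as well. Each rule that could have produced a → b, transported
    -- along b – c, compels either a → c or one of the lines. The induction is on the rank of b, and
    -- is applied at parents of b.
    cases hab with
    | forced h =>
      rcases h.2 with ⟨d, hdb, hne, hadj'⟩ | ⟨j, hj⟩
      · have hd : Compelled 𝓘 D d b :=
          .forced (forced_of_collider hdb h.1 hne.symm fun hh => hadj' hh.symm)
        exact hcb (compelled_of_kite hD (.forced h) hd hne hadj' hl.1.symm (hadj hd).symm
          hbc.1.symm hl.2.1)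
      · exact hj ((hl.mem_iff j).trans (hbc.mem_iff j).symm)
    | @chain d _ _ hda hE hdb =>
      have hdc := IH hE hda hl
      have hne : d ≠ b := fun e => hD.asymm hE (e ▸ hda.E)
      exact (hdc.of_not_adj hbc.1.symm hne hdb).elim hbc.2.2 hbc.2.1
    | @triangle _ d _ had hdb hE =>
      -- Either a → d → c is a compelled triangle, or d – c is a line and the induction hypothesis
      -- applies at d.
      by_cases hdc : Compelled 𝓘 D d c
      · exact hac (.triangle had hdc (hD.E_of_path had.E hdc.E hl.1))
      · exact hac (IH hdb.E had (hline hdb hdc))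
    | @kite _ _ d e hE hdb heb hne hde had hae =>
      by_cases hdc : Compelled 𝓘 D d c
      · by_cases hec : Compelled 𝓘 D e c
        · exact hac (.kite (hD.E_of_path had hdc.E hl.1) hdc hec hne hde had hae)
        · have := hline heb hec
          exact (hdc.of_not_adj this.1.symm hne hde).elim this.2.2 this.2.1
      · exact hcb (compelled_of_kite hD hdb heb hne hde (hadj hdb).symm (hadj heb).symm
          hbc.1.symm hdc)

end Compelled

/-! ### Simplicial vertices and perfect elimination orderings -/

section Rooted

variable {A : V → V → Prop}

/-- The neighbors of `s` in `S` are pairwise adjacent. -/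
def SimplicialIn (A : V → V → Prop) (S : Finset V) (s : V) : Prop :=
  ∀ x ∈ S, ∀ y ∈ S, A x s → A y s → x ≠ y → A x y

/-- The ordering of the vertices by `f` is a perfect elimination ordering of `A`. -/
def IsEliminationRank (A : V → V → Prop) (S : Finset V) (f : V → ℕ) : Prop :=
  ∀ s ∈ S, SimplicialIn A (S.filter fun x => f x < f s) s

/-- Dirac's theorem, by induction on the last vertex s, which is simplicial. Of two nonadjacent
simplicial vertices of the rest, at least one is not adjacent to s; it stays simplicial and pairs
with s. -/
theorem exists_simplicial [DecidableEq V] (hsymm : ∀ a b, A a b → A b a) (hirr : ∀ a, ¬ A a a)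
    {f : V → ℕ} (S : Finset V) (hf : Set.InjOn f S) (hS : IsEliminationRank A S f) :
    (∀ x ∈ S, ∀ y ∈ S, x ≠ y → A x y) ∨
      ∃ u ∈ S, ∃ v ∈ S, u ≠ v ∧ ¬ A u v ∧ SimplicialIn A S u ∧ SimplicialIn A S v := by
  induction S using Finset.induction_on_max_value f with
  | empty => simp
  | insert s S hs hmax ih =>
    have hlt : ∀ x ∈ S, f x < f s := fun x hx => lt_of_le_of_ne (hmax x hx) fun e =>
      hs (hf (by simp [hx]) (by simp) e ▸ hx)
    have hsimp : SimplicialIn A (insert s S) s := by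
      have := hS s (by simp)
      intro x hx y hy hxs hys
      have hx' : x ∈ S := (Finset.mem_insert.1 hx).resolve_left fun e => hirr s (e ▸ hxs)
      have hy' : y ∈ S := (Finset.mem_insert.1 hy).resolve_left fun e => hirr s (e ▸ hys)
      exact this x (by simp [hx', hlt]) y (by simp [hy', hlt]) hxs hys
    have hlift : ∀ u, SimplicialIn A S u → ¬ A u s → SimplicialIn A (insert s S) u := by
      intro u hu hus x hx y hy hxu hyu
      have hx' : x ∈ S := (Finset.mem_insert.1 hx).resolve_left fun e => hus (hsymm _ _ (e ▸ hxu))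
      have hy' : y ∈ S := (Finset.mem_insert.1 hy).resolve_left fun e => hus (hsymm _ _ (e ▸ hyu))
      exact hu x hx' y hy' hxu hyu
    have hS' : IsEliminationRank A S f := fun t ht x hx y hy => hS t (by simp [ht])
      x (by simp at hx ⊢; tauto) y (by simp at hy ⊢; tauto)
    rcases ih (hf.mono (by simp)) hS' with hc | ⟨u, hu, v, hv, huv, hA, hsu, hsv⟩
    · by_cases hall : ∀ x ∈ S, A x s
      · left
        intro x hx y hy hxy
        rcases Finset.mem_insert.1 hx with ex | hx' <;> rcases Finset.mem_insert.1 hy with ey | hy'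
        · exact (hxy (ex.trans ey.symm)).elim
        · exact ex ▸ hsymm _ _ (hall y hy')
        · exact ey ▸ hall x hx'
        · exact hc x hx' y hy' hxy
      · push Not at hall
        obtain ⟨w, hw, hws⟩ := hall
        refine Or.inr ⟨w, by simp [hw], s, by simp, fun e => hs (e ▸ hw), hws,
          hlift w (fun x hx y hy _ _ => hc x hx y hy) hws, hsimp⟩
    · right
      by_cases hus : A u s
      · have hvs : ¬ A v s := fun hvs => hA (hsimp u (by simp [hu]) v (by simp [hv]) hus hvs huv)
        exact ⟨v, by simp [hv], s, by simp, fun e => hs (e ▸ hv), hvs, hlift v hsv hvs, hsimp⟩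
      · exact ⟨u, by simp [hu], s, by simp, fun e => hs (e ▸ hu), hus, hlift u hsu hus, hsimp⟩

/-- A perfect elimination ordering can be made to start at any given vertex. -/
theorem exists_rooted_eliminationRank [DecidableEq V] (hsymm : ∀ a b, A a b → A b a)
    (hirr : ∀ a, ¬ A a a) {f : V → ℕ} (S : Finset V) (hf : Set.InjOn f S)
    (hS : IsEliminationRank A S f) {r : V} (hr : r ∈ S) :
    ∃ g : V → ℕ, Set.InjOn g S ∧ IsEliminationRank A S g ∧ ∀ x ∈ S, x ≠ r → g r < g x := by
  induction hn : S.card generalizing S with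
  | zero => simp [Finset.card_eq_zero.1 hn] at hr
  | succ n ih =>
    -- Order the rest recursively and put such an s last. By Dirac's theorem, one exists unless r is
    -- the only vertex.
    by_cases hex : ∃ s ∈ S, s ≠ r ∧ SimplicialIn A S s
    · obtain ⟨s, hs, hsr, hsimp⟩ := hex
      have hS' : IsEliminationRank A (S.erase s) f := fun t ht x hx y hy =>
        hS t (Finset.mem_of_mem_erase ht) x (by simp at hx ⊢; tauto) y (by simp at hy ⊢; tauto)
      obtain ⟨g, hg, hg', hgr⟩ := ih (S.erase s) (hf.mono (by simp)) hS'
        (Finset.mem_erase.2 ⟨hsr.symm, hr⟩) (by rw [Finset.card_erase_of_mem hs]; omega)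
      -- A rank above all others, which makes s the last vertex.
      let M := S.sup g + 1
      have hM : ∀ x ∈ S, g x < M := fun x hx => Nat.lt_succ_of_le (Finset.le_sup hx)
      have hs' : Function.update g s M s = M := by simp
      have hne : ∀ x, x ≠ s → Function.update g s M x = g x := fun x hx => by simp [hx]
      refine ⟨Function.update g s M, ?_, ?_, ?_⟩
      · intro x hx y hy hxy
        by_cases hxs : x = s <;> by_cases hys : y = s
        · exact hxs.trans hys.symm
        · rw [hxs, hs', hne y hys] at hxy
          exact absurd (hM y hy) (by omega)
        · rw [hys, hs', hne x hxs] at hxy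
          exact absurd (hM x hx) (by omega)
        · rw [hne x hxs, hne y hys] at hxy
          exact hg (by simpa [hxs] using hx) (by simpa [hys] using hy) hxy
      · intro t ht x hx y hy
        rw [Finset.mem_filter] at hx hy
        by_cases hts : t = s
        · subst hts
          exact hsimp x hx.1 y hy.1
        · have aux : ∀ z, z ∈ S ∧ Function.update g s M z < Function.update g s M t →
              z ∈ (S.erase s).filter fun x => g x < g t := by
            rintro z ⟨hz, hzt⟩
            rw [hne t hts] at hzt
            by_cases hzs : z = s
            · rw [hzs, hs'] at hzt
              exact absurd (hM t ht) (by omega)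
            · rw [hne z hzs] at hzt
              simp [hz, hzs, hzt]
          exact hg' t (by simp [hts, ht]) x (aux x hx) y (aux y hy)
      · intro x hx hxr
        rw [hne r hsr.symm]
        by_cases hxs : x = s
        · rw [hxs, hs']
          exact hM r hr
        · rw [hne x hxs]
          exact hgr x (by simp [hxs, hx]) hxr
    · push Not at hex
      have hone : ∀ x ∈ S, x = r := by
        rcases exists_simplicial hsymm hirr S hf hS with hc | ⟨u, hu, v, hv, huv, -, hsu, hsv⟩
        · intro x hx
          by_contra hxr
          exact hex x hx hxr fun y hy z hz _ _ => hc y hy z hz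
        · by_cases hur : u = r
          · exact (hex v hv (fun e => huv (hur.trans e.symm)) hsv).elim
          · exact (hex u hu hur hsu).elim
      exact ⟨f, hf, hS, fun x hx hxr => (hxr (hone x hx)).elim⟩

end Rooted

/-! ### Chordality of the line graph and reorientation of lines -/

section Reversal

variable [Finite V] {𝓘 : ι → Finset V} {D : EGraph V}

/-- This makes every topological ordering of `D` a perfect elimination ordering of the line graph.
Nonadjacent x and y would form a v-structure at z, and a compelled edge between them would extend
along a line to z. -/
theorem Line.adj_of_lt (hD : D.IsDAG) {f : V → ℕ} (hlt : ∀ a b, D.E a b → f a < f b) {x y z : V} (hxz : Line 𝓘 D x z) (hyz : Line 𝓘 D y z)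
    (hx : f x < f z) (hy : f y < f z) (hxy : x ≠ y) : Line 𝓘 D x y := by
  have hE : ∀ {u}, Line 𝓘 D u z → f u < f z → D.E u z := fun hu h =>
    hu.1.resolve_right fun h' => absurd (hlt _ _ h') (by omega)
  refine ⟨?_, fun h => hxz.2.1 (h.trans_line hD hyz), fun h => hyz.2.1 (h.trans_line hD hxz)⟩
  by_contra hadj
  exact hxz.2.1 (.forced (forced_of_collider (hE hxz hx) (hE hyz hy) hxy hadj))

theorem Compelled.trans_lines (hD : D.IsDAG) {a b c : V} (hab : Compelled 𝓘 D a b)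
    (hbc : Relation.ReflTransGen (Line 𝓘 D) b c) : Compelled 𝓘 D a c := by
  induction hbc with
  | refl => exact hab
  | tail _ h ih => exact ih.trans_line hD h

theorem transGen_compelled_trans_lines (hD : D.IsDAG) {a b c : V}
    (hab : Relation.TransGen (Compelled 𝓘 D) a b)
    (hbc : Relation.ReflTransGen (Line 𝓘 D) b c) : Relation.TransGen (Compelled 𝓘 D) a c := by
  rcases Relation.TransGen.tail'_iff.1 hab with ⟨d, had, hdb⟩
  exact Relation.TransGen.tail' had (hdb.trans_lines hD hbc)

/-- Keep the compelled edges, and orient the lines along `g`. -/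
def reorient (𝓘 : ι → Finset V) (D : EGraph V) (g : V → ℕ) : EGraph V where
  E a b := Compelled 𝓘 D a b ∨ (Line 𝓘 D a b ∧ g a < g b)
  irrefl a h := h.elim (fun h => D.irrefl a h.E) fun h => lt_irrefl _ h.2

theorem IsDAG.reorient (hD : D.IsDAG) (g : V → ℕ) : (reorient 𝓘 D g).IsDAG := by
  refine isDAG_of_acyclic fun a ha => ?_
  -- A line that follows a compelled edge is absorbed into it. So a walk either uses only lines,
  -- along which g increases, or becomes lines followed by compelled edges; a closed walk of the
  -- second kind yields a compelled cycle.
  have key : ∀ u v, Relation.TransGen (EGraph.reorient 𝓘 D g).E u v →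
      (Relation.ReflTransGen (Line 𝓘 D) u v ∧ g u < g v) ∨
      ∃ w, Relation.ReflTransGen (Line 𝓘 D) u w ∧ Relation.TransGen (Compelled 𝓘 D) w v := by
    intro u v h
    induction h with
    | single h =>
      rcases h with h | h
      · exact Or.inr ⟨u, .refl, .single h⟩
      · exact Or.inl ⟨.single h.1, h.2⟩
    | tail _ h ih =>
      rcases ih with ih | ⟨w, hw, ih⟩ <;> rcases h with h | h
      · exact Or.inr ⟨_, ih.1, .single h⟩
      · exact Or.inl ⟨ih.1.tail h.1, ih.2.trans h.2⟩
      · exact Or.inr ⟨w, hw, ih.tail h⟩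
      · exact Or.inr ⟨w, hw, transGen_compelled_trans_lines hD ih (.single h.1)⟩
  rcases key a a ha with h | ⟨w, hw, h⟩
  · exact lt_irrefl _ h.2
  · exact not_transGen_compelled hD w (transGen_compelled_trans_lines hD h hw)

/-- A digraph made of the compelled edges of `D` and an orientation of its lines without
v-structures is equivalent to `D`. -/
theorem structEquiv_of_compelled (hD : D.IsDAG) {D' : EGraph V}
    (hadj : ∀ a b, D'.Adj a b ↔ D.Adj a b) (hcomp : ∀ a b, Compelled 𝓘 D a b → D'.E a b)
    (hE : ∀ a b, D'.E a b → Compelled 𝓘 D a b ∨ Line 𝓘 D a b)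
    (hv : ∀ a b c, Line 𝓘 D a b → Line 𝓘 D c b → D'.E a b → D'.E c b → a ≠ c → D.Adj a c) :
    StructEquiv 𝓘 D' D := by
  refine ⟨hadj, fun a b => ⟨?_, ?_⟩⟩
  · rintro ⟨hab, ⟨c, hcb, hne, hac⟩ | ⟨j, hj⟩⟩
    · rw [hadj] at hac
      rcases hE _ _ hab with h | h <;> rcases hE _ _ hcb with h' | h'
      · exact forced_of_collider h.E h'.E hne hac
      · exact (hac (Or.inl (h.trans_line hD h'.symm).E)).elim
      · exact (hac (Or.inr (h'.trans_line hD h.symm).E)).elim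
      · exact (hac (hv a b c h h' hab hcb hne)).elim
    · rcases hE _ _ hab with h | h
      · exact ⟨h.E, Or.inr ⟨j, hj⟩⟩
      · exact (hj (h.mem_iff j)).elim
  · intro h
    refine ⟨hcomp _ _ (.forced h), h.2.imp_left ?_⟩
    rintro ⟨c, hcb, hne, hac⟩
    exact ⟨c, hcomp _ _ (.forced (forced_of_collider hcb h.1 hne.symm fun h => hac h.symm)), hne,
      fun h => hac ((hadj _ _).1 h)⟩

/-- Edges that are not compelled can be reversed in an equivalent acyclic digraph. -/
theorem Line.exists_structEquiv (hD : D.IsDAG) {a b : V} (h : Line 𝓘 D a b) :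
    ∃ D' : EGraph V, D'.IsDAG ∧ StructEquiv 𝓘 D' D ∧ D'.E a b := by
  classical
  cases nonempty_fintype V
  obtain ⟨f, hf, hlt⟩ := hD.exists_rank
  have hirr : ∀ v, ¬ Line 𝓘 D v v := fun v hv => hv.1.ne rfl
  -- Rooting the ordering at a orients the line as a → b.
  obtain ⟨g, hg, hel, hgr⟩ := exists_rooted_eliminationRank (A := Line 𝓘 D)
    (fun _ _ h => h.symm) hirr
    Finset.univ hf.injOn (fun s _ x hx y hy hxs hys hxy => hxs.adj_of_lt hD hlt hys
      (Finset.mem_filter.1 hx).2 (Finset.mem_filter.1 hy).2 hxy) (Finset.mem_univ a)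
  refine ⟨reorient 𝓘 D g, hD.reorient g, structEquiv_of_compelled hD ?_ (fun _ _ h => Or.inl h)
    (fun _ _ h => h.imp_right fun h => h.1) ?_, Or.inr ⟨h, hgr b (Finset.mem_univ b) h.1.ne.symm⟩⟩
  · have haux : ∀ {u v}, D.E u v → (reorient 𝓘 D g).Adj u v := fun {u v} huv => by
      rcases E.compelled_or_line (𝓘 := 𝓘) hD huv with hc | hl
      · exact Or.inl (Or.inl hc)
      · rcases lt_or_gt_of_ne fun e : g u = g v =>
          E.ne huv (hg (Finset.mem_coe.2 (Finset.mem_univ _)) (Finset.mem_coe.2 (Finset.mem_univ _)) e)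
          with hh | hh
        · exact Or.inl (Or.inr ⟨hl, hh⟩)
        · exact Or.inr (Or.inr ⟨hl.symm, hh⟩)
    refine fun u v => ⟨?_, fun h => h.elim haux fun h => (haux h).symm⟩
    rintro ((h | h) | (h | h))
    exacts [Or.inl h.E, h.1.1, Or.inr h.E, h.1.1.symm]
  · intro x z y hx hy hxz hyz hxy
    have haux : ∀ {u}, Line 𝓘 D u z → (reorient 𝓘 D g).E u z → g u < g z := fun hu hE =>
      hE.elim (fun h => (hu.2.1 h).elim) fun h => h.2
    exact (hel z (Finset.mem_univ z) x (by simp [haux hx hxz]) y (by simp [haux hy hyz])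
      hx hy hxy).1

end Reversal

end EGraph

namespace EGraph

variable {V ι : Type*}

/-! ### The essential graph and its perfect orientations -/

section Essential

theorem reach_mono {G H : EGraph V} (h : G.IsSubgraph H) {a b : V} (hab : G.Reach a b) :
    H.Reach a b := Relation.ReflTransGen.mono h _ _ hab

variable [Finite V] {𝓘 : ι → Finset V} {D D' : EGraph V}

/-- The union of all acyclic digraphs that are equivalent to `D`. -/
def structEssential (𝓘 : ι → Finset V) (D : EGraph V) : EGraph V :=
  union {D' | D'.IsDAG ∧ StructEquiv 𝓘 D' D}

theorem structEssential_E (hD : D.IsDAG) {a b : V} :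
    (structEssential 𝓘 D).E a b ↔ Compelled 𝓘 D a b ∨ Line 𝓘 D a b := by
  constructor
  · rintro ⟨D', ⟨hD', h⟩, hab⟩
    by_cases hc : Compelled 𝓘 D a b
    · exact Or.inl hc
    · exact Or.inr ⟨(h.1 a b).1 (Or.inl hab), hc, fun hc' =>
        hD'.asymm hab (hc'.E_of_structEquiv hD hD' h.symm)⟩
  · rintro (h | h)
    · exact ⟨D, ⟨hD, .refl D⟩, h.E⟩
    · obtain ⟨D', hD', hs, hab⟩ := h.exists_structEquiv hD
      exact ⟨D', ⟨hD', hs⟩, hab⟩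

theorem structEssential_adj (hD : D.IsDAG) {a b : V} :
    (structEssential 𝓘 D).Adj a b ↔ D.Adj a b := by
  simp only [Adj, structEssential_E hD]
  constructor
  · rintro ((h | h) | (h | h))
    exacts [Or.inl h.E, h.1, Or.inr h.E, h.1.symm]
  · rintro (h | h)
    · exact Or.inl (E.compelled_or_line hD h)
    · exact Or.inr (E.compelled_or_line hD h)

/-- Once a walk has used a compelled edge, later lines are absorbed. A compelled edge inside a chain
component would thus close a compelled cycle. -/
theorem Compelled.trans_reach (hD : D.IsDAG) {a b c : V} (h : Compelled 𝓘 D a b)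
    (hbc : (structEssential 𝓘 D).Reach b c) : Relation.TransGen (Compelled 𝓘 D) a c := by
  induction hbc with
  | refl => exact .single h
  | tail _ h ih =>
    rcases (structEssential_E hD).1 h with h | h
    · exact ih.tail h
    · exact transGen_compelled_trans_lines hD ih (.single h)

/-- No compelled edge joins two vertices of the same chain component. -/
theorem Compelled.not_reach (hD : D.IsDAG) {a b : V} (h : Compelled 𝓘 D a b) :
    ¬ (structEssential 𝓘 D).Reach b a :=
  fun h' => not_transGen_compelled hD a (h.trans_reach hD h')

theorem IsDAG.isPerfectOrientationOf (hD : D.IsDAG) (hD' : D'.IsDAG) (h : StructEquiv 𝓘 D' D) :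
    D'.IsPerfectOrientationOf (structEssential 𝓘 D) := by
  classical
  have hsub : D'.IsSubgraph (structEssential 𝓘 D) := fun a b hab => ⟨D', ⟨hD', h⟩, hab⟩
  refine ⟨hD'.1, hsub, ?_, ?_⟩
  · ext a b
    exact (h.1 a b).trans (structEssential_adj hD).symm
  · rintro T ⟨a, rfl⟩
    set T : Set V := {b | (structEssential 𝓘 D).Reach a b ∧ (structEssential 𝓘 D).Reach b a}
    cases nonempty_fintype T
    obtain ⟨f, hf, hlt⟩ := hD'.exists_rank
    let o : LinearOrder T := LinearOrder.lift' (fun t : T => f t)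
      fun s t hst => Subtype.ext (hf hst)
    let σ := Fintype.orderIsoFinOfCardEq T rfl
    have hσ : ∀ {s t : T}, σ.symm s ≤ σ.symm t ↔ f s ≤ f t := σ.symm.le_iff_le
    refine ⟨_, σ.toEquiv, ?_, ?_⟩
    · rintro i b ⟨hb, j, hj, rfl⟩ c ⟨hc, k, hk, rfl⟩ hbc
      have haux : ∀ j ≤ i, (structEssential 𝓘 D).Adj (σ i) (σ j) → D'.E (σ j) (σ i) := by
        intro j hj hadj
        rw [structEssential_adj hD, ← h.1] at hadj
        refine hadj.resolve_left fun hE => ?_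
        have h2 : f (σ j) ≤ f (σ i) := hσ.1 (by simpa using hj)
        exact absurd (hlt _ _ hE) (by omega)
      have h1 := haux j hj hb
      have h2 := haux k hk hc
      change (structEssential 𝓘 D).Adj (σ j) (σ k)
      rw [structEssential_adj hD, ← h.1]
      by_contra hadj
      -- Nonadjacent earlier neighbors would form a v-structure, that is, a compelled edge within
      -- one chain component.
      have hforced : Forced 𝓘 D' (σ j) (σ i) :=
        forced_of_collider h1 h2 (fun e => hbc (Subtype.ext e)) hadj
      exact (Compelled.forced ((h.2 _ _).1 hforced)).not_reach hD
        ((σ i).2.2.trans (σ j).2.1)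
    · intro s t hst
      refine hσ.2 ?_
      induction hst with
      | refl => exact le_rfl
      | tail _ h ih => exact ih.trans (hlt _ _ h).le

theorem IsPerfectOrientationOf.isDAG_and_structEquiv (hD : D.IsDAG)
    (h : D'.IsPerfectOrientationOf (structEssential 𝓘 D)) : D'.IsDAG ∧ StructEquiv 𝓘 D' D := by
  obtain ⟨-, hsub, hskel, hT⟩ := h
  have hcomp : ∀ a, ∃ (n : ℕ) (σ : Fin n ≃ {b | (structEssential 𝓘 D).Reach a b ∧
      (structEssential 𝓘 D).Reach b a}), ((structEssential 𝓘 D).induce _).IsPerfectElimination σ ∧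
      (D'.induce _).IsOrientedAccordingTo σ := fun a => hT _ ⟨a, rfl⟩
  have hadj : ∀ a b, D'.Adj a b ↔ D.Adj a b := fun a b =>
    (iff_of_eq (congrFun (congrFun (congrArg EGraph.E hskel) a) b)).trans (structEssential_adj hD)
  have hE : ∀ a b, D'.E a b → Compelled 𝓘 D a b ∨ Line 𝓘 D a b := fun a b hab =>
    (structEssential_E hD).1 (hsub a b hab)
  have hline : ∀ {a b}, Line 𝓘 D a b → (structEssential 𝓘 D).Reach a b := fun h =>
    .single ((structEssential_E hD).2 (Or.inr h))
  refine ⟨isDAG_of_acyclic fun a ha => ?_, structEquiv_of_compelled hD hadj ?_ hE ?_⟩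
  · obtain ⟨c, hac, hca⟩ := Relation.TransGen.head'_iff.1 ha
    obtain ⟨n, σ, -, hσ⟩ := hcomp a
    have hra : (structEssential 𝓘 D).Reach a c := .single (hsub _ _ hac)
    -- A directed cycle through a stays in the chain component of a. Positions weakly increase along
    -- it, so a and its successor c coincide.
    have key : ∀ x (hx : D'.Reach x a) (hx' : (structEssential 𝓘 D).Reach a x),
        σ.symm ⟨x, hx', reach_mono hsub hx⟩ ≤ σ.symm ⟨a, .refl, .refl⟩ := by
      intro x hx
      induction hx using Relation.ReflTransGen.head_induction_on with
      | refl => exact fun _ => le_rfl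
      | head h h' ih =>
        intro hx'
        have hx'' := hx'.tail (hsub _ _ h)
        exact (hσ ⟨_, hx', reach_mono hsub (.head h h')⟩ ⟨_, hx'', reach_mono hsub h'⟩
          (.single h)).trans (ih hx'')
    have h1 := key c hca hra
    have h2 := hσ ⟨a, .refl, .refl⟩ ⟨c, hra, reach_mono hsub hca⟩ (.single hac)
    have h3 := congrArg Subtype.val (σ.symm.injective (le_antisymm h1 h2))
    exact E.ne hac h3.symm
  · intro a b hab
    refine ((hadj a b).2 (Or.inl hab.E)).resolve_right fun hba => ?_
    rcases hE _ _ hba with hc | hl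
    · exact hD.asymm hab.E hc.E
    · exact hl.2.2 hab
  · intro a b c hab hcb hab' hcb' hne
    obtain ⟨n, σ, hpe, hσ⟩ := hcomp b
    have haux : ∀ {a}, Line 𝓘 D a b → a ∈ {c | (structEssential 𝓘 D).Reach b c ∧
      (structEssential 𝓘 D).Reach c b} := fun hl => ⟨hline hl.symm, hline hl⟩
    have hmem : ∀ {a} (hl : Line 𝓘 D a b), D'.E a b → (⟨a, haux hl⟩ : Subtype _) ∈
        {c | ((structEssential 𝓘 D).induce _).Adj (σ (σ.symm ⟨b, .refl, .refl⟩)) c ∧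
          ∃ j ≤ σ.symm ⟨b, .refl, .refl⟩, σ j = c} := by
      intro a hl hE'
      refine ⟨?_, σ.symm ⟨a, haux hl⟩, hσ _ _ (.single hE'), by simp⟩
      rw [Equiv.apply_symm_apply]
      exact (structEssential_adj hD).2 hl.1.symm
    exact (structEssential_adj hD).1 (hpe _ (hmem hab hab') (hmem hcb hcb')
      fun e => hne (congrArg Subtype.val e))

end Essential

end EGraph

/-! ### Marginals with respect to σ-finite product measures -/

section Marginal

variable {δ : Type*} [DecidableEq δ] {X : δ → Type*} [∀ i, MeasurableSpace (X i)]
  {μ : ∀ i, Measure (X i)}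

theorem lmarginal_mul_left {s : Finset δ} {f g : (∀ i, X i) → ℝ≥0∞} (hf : Measurable f)
    (hg : ∀ x y : ∀ i, X i, (∀ i ∉ s, x i = y i) → g x = g y) (x : ∀ i, X i) :
    lmarginal μ s (fun x => g x * f x) x = g x * lmarginal μ s f x := by
  have h : ∀ y, g (Function.updateFinset x s y) = g x := fun y =>
    hg _ _ fun i hi => by simp [Function.updateFinset, hi]
  simp only [lmarginal, h]
  exact lintegral_const_mul _ (hf.comp measurable_updateFinset)

theorem lmarginal_pos [∀ i, SigmaFinite (μ i)] (hμ : ∀ i, μ i ≠ 0) (s : Finset δ)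
    {f : (∀ i, X i) → ℝ≥0∞} (hf : Measurable f) (hpos : ∀ x, 0 < f x) (x : ∀ i, X i) :
    0 < lmarginal μ s f x := by
  refine (lintegral_pos_iff_support (hf.comp measurable_updateFinset)).2 ?_
  have : Function.support (f ∘ Function.updateFinset x s) = Set.univ :=
    Set.eq_univ_of_forall fun y => (hpos _).ne'
  rw [this, Measure.pi_univ, pos_iff_ne_zero, Finset.prod_ne_zero_iff]
  exact fun i _ => by simpa using hμ i

variable [Fintype δ] [∀ i, SigmaFinite (μ i)]

theorem lmarginal_lmarginal_compl {f : (∀ i, X i) → ℝ≥0∞} (hf : Measurable f) (s : Finset δ) :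
    lmarginal μ s (lmarginal μ sᶜ f) = fun _ => ∫⁻ x, f x ∂Measure.pi μ := by
  rw [← lmarginal_union μ f hf disjoint_compl_right, Finset.union_compl, lmarginal_univ]

theorem lintegral_eq_zero_of_lmarginal {f : (∀ i, X i) → ℝ≥0∞} (hf : Measurable f) (s : Finset δ)
    (h : lmarginal μ s f = 0) : ∫⁻ x, f x ∂Measure.pi μ = 0 := by
  rw [lintegral_eq_of_lmarginal_eq s hf measurable_zero (h.trans ?_)]
  · simp
  · ext x; simp [lmarginal]

/-- The marginal is constant in the coordinates of s, which may have infinite measure, so its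
integral need not equal that of f. Vanishing is nevertheless inherited. -/
theorem lintegral_lmarginal_eq_zero {f : (∀ i, X i) → ℝ≥0∞} (hf : Measurable f) (s : Finset δ)
    (h : ∫⁻ x, f x ∂Measure.pi μ = 0) : ∫⁻ x, lmarginal μ s f x ∂Measure.pi μ = 0 := by
  refine lintegral_eq_zero_of_lmarginal (hf.lmarginal μ) sᶜ ?_
  have := lmarginal_lmarginal_compl (μ := μ) hf sᶜ
  rw [compl_compl] at this
  rw [this, h]
  rfl

theorem lmarginal_congr_ae {f g : (∀ i, X i) → ℝ≥0∞} (s : Finset δ)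
    (h : ∀ᵐ x ∂Measure.pi μ, f x = g x) :
    ∀ᵐ x ∂Measure.pi μ, lmarginal μ s f x = lmarginal μ s g x := by
  -- Tonelli for the exceptional set: almost every section of N in the directions of s is null.
  obtain ⟨N, hN, hNm, hN0⟩ := exists_measurable_superset_of_null h
  let φ : (∀ i, X i) → ℝ≥0∞ := N.indicator 1
  have hφ : Measurable φ := measurable_one.indicator hNm
  have h0 : ∫⁻ x, φ x ∂Measure.pi μ = 0 := by rw [lintegral_indicator_one hNm, hN0]
  have h1 := (lintegral_eq_zero_iff (hφ.lmarginal μ)).1 (lintegral_lmarginal_eq_zero hφ s h0)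
  filter_upwards [h1] with x hx
  have h2 := (lintegral_eq_zero_iff (hφ.comp measurable_updateFinset)).1 hx
  refine lintegral_congr_ae ?_
  filter_upwards [h2] with y hy
  by_contra hne
  have : Function.updateFinset x s y ∈ N := hN hne
  simp [φ, this] at hy

theorem lmarginal_lt_top_ae {f : (∀ i, X i) → ℝ≥0∞} (hf : Measurable f) (s : Finset δ)
    (h : ∫⁻ x, f x ∂Measure.pi μ ≠ ∞) : ∀ᵐ x ∂Measure.pi μ, lmarginal μ s f x ≠ ∞ := by
  let N : Set (∀ i, X i) := {x | lmarginal μ s f x = ∞}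
  have hNm : MeasurableSet N := hf.lmarginal μ (measurableSet_singleton ∞)
  let φ : (∀ i, X i) → ℝ≥0∞ := N.indicator 1
  have hφ : Measurable φ := measurable_one.indicator hNm
  -- Integrating this bound over the complement of s gives ∞ times the marginal of φ, at most ∫ f <
  -- ∞; so the marginal of φ vanishes and N is null.
  have hle : (fun x => ∞ * φ x) ≤ lmarginal μ s f := by
    intro x
    by_cases hx : x ∈ N
    · exact le_of_le_of_eq le_top (Eq.symm hx)
    · simp [φ, hx]
  have h0 : lmarginal μ sᶜ φ = 0 := by
    ext x
    have h1 := lmarginal_mono (μ := μ) (s := sᶜ) hle x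
    have h2 := lmarginal_lmarginal_compl (μ := μ) hf sᶜ
    rw [compl_compl] at h2
    rw [h2, lmarginal_mul_left hφ (fun _ _ _ => rfl)] at h1
    by_contra hne
    rw [ENNReal.top_mul hne] at h1
    exact h (top_le_iff.1 h1)
  have h3 := lintegral_eq_zero_of_lmarginal hφ sᶜ h0
  rw [lintegral_indicator_one hNm] at h3
  exact measure_eq_zero_iff_ae_notMem.1 h3

end Marginal

/-! ### Conditional densities and the chain rule -/

section Conditional

variable {p : ℕ} {X : Fin p → Type*} [∀ i, MeasurableSpace (X i)] {μ : ∀ i, Measure (X i)}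

theorem marginalDensity_congr (f : (∀ i, X i) → ℝ≥0∞) (A : Finset (Fin p)) {x y : ∀ i, X i}
    (h : ∀ i ∈ A, x i = y i) : marginalDensity μ f A x = marginalDensity μ f A y :=
  lmarginal_congr μ f fun i hi => h i (by simpa using hi)

variable [∀ i, SigmaFinite (μ i)]

theorem marginalDensity_eq_lmarginal {f : (∀ i, X i) → ℝ≥0∞} (hf : Measurable f)
    {A : Finset (Fin p)} {a : Fin p} (ha : a ∉ A) :
    marginalDensity μ f A = lmarginal μ {a} (marginalDensity μ f (insert a A)) := by
  have : Aᶜ = {a} ∪ (insert a A)ᶜ := by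
    ext i
    simp only [Finset.mem_compl, Finset.mem_union, Finset.mem_singleton, Finset.mem_insert]
    by_cases hi : i = a
    · simp [hi, ha]
    · simp [hi]
  have hd : Disjoint {a} (insert a A)ᶜ := by simp
  change lmarginal μ Aᶜ f = lmarginal μ {a} (lmarginal μ (insert a A)ᶜ f)
  rw [this, lmarginal_union μ f hf hd]

variable {f g : (∀ i, X i) → ℝ≥0∞}

theorem marginalDensity_ne_top (hf : f ∈ posDensities μ) (A : Finset (Fin p)) :
    ∀ᵐ x ∂Measure.pi μ, marginalDensity μ f A x ≠ ∞ :=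
  lmarginal_lt_top_ae hf.1 _ (by simp [hf.2.2])

theorem marginalDensity_ne_zero (hμ : ∀ i, μ i ≠ 0) (hf : f ∈ posDensities μ)
    (A : Finset (Fin p)) (x : ∀ i, X i) : marginalDensity μ f A x ≠ 0 :=
  (lmarginal_pos hμ _ hf.1 (fun x => (hf.2.1 x).1) x).ne'

theorem div_mul_div_cancel_mid {u v w : ℝ≥0∞} (h0 : u ≠ 0) (ht : u ≠ ∞) :
    u / v * (w / u) = w / v := by
  rw [div_eq_mul_inv, div_eq_mul_inv, div_eq_mul_inv]
  calc u * v⁻¹ * (w * u⁻¹) = (u * u⁻¹) * (w * v⁻¹) := by ring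
    _ = w * v⁻¹ := by rw [ENNReal.mul_inv_cancel h0 ht, one_mul]

/-- The chain rule for conditional densities. -/
theorem condDensity_mul (hμ : ∀ i, μ i ≠ 0) (hf : f ∈ posDensities μ) (a b : Fin p)
    (A : Finset (Fin p)) : ∀ᵐ x ∂Measure.pi μ,
      condDensity μ f a A x * condDensity μ f b (insert a A) x =
        marginalDensity μ f (insert b (insert a A)) x / marginalDensity μ f A x := by
  filter_upwards [marginalDensity_ne_top hf (insert a A)] with x hx
  exact div_mul_div_cancel_mid (marginalDensity_ne_zero hμ hf _ x) hx

theorem condDensity_mul_comm (hμ : ∀ i, μ i ≠ 0) (hf : f ∈ posDensities μ) (a b : Fin p)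
    (A : Finset (Fin p)) : ∀ᵐ x ∂Measure.pi μ,
      condDensity μ f a A x * condDensity μ f b (insert a A) x =
        condDensity μ f b A x * condDensity μ f a (insert b A) x := by
  filter_upwards [condDensity_mul hμ hf a b A, condDensity_mul hμ hf b a A] with x h1 h2
  rw [h1, h2, Finset.insert_comm]

/-- Equality of the conditional densities of `a` given `A` and of `b` given `a` and `A` entails
equality of the conditional densities of `b` given `A`, and of `a` given `b` and `A`. -/
theorem condDensity_swap (hμ : ∀ i, μ i ≠ 0) (hf : f ∈ posDensities μ) (hg : g ∈ posDensities μ)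
    {a b : Fin p} {A : Finset (Fin p)} (hab : a ≠ b) (ha : a ∉ A)
    (h₁ : ∀ᵐ x ∂Measure.pi μ, condDensity μ f a A x = condDensity μ g a A x)
    (h₂ : ∀ᵐ x ∂Measure.pi μ,
      condDensity μ f b (insert a A) x = condDensity μ g b (insert a A) x) :
    (∀ᵐ x ∂Measure.pi μ, condDensity μ f b A x = condDensity μ g b A x) ∧
      ∀ᵐ x ∂Measure.pi μ,
        condDensity μ f a (insert b A) x = condDensity μ g a (insert b A) x := by
  have hmeas : ∀ {h} (B : Finset (Fin p)), Measurable h → Measurable (marginalDensity μ h B) :=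
    fun B hh => hh.lmarginal μ
  have hratio : ∀ᵐ x ∂Measure.pi μ, marginalDensity μ f (insert b (insert a A)) x /
      marginalDensity μ f A x = marginalDensity μ g (insert b (insert a A)) x /
      marginalDensity μ g A x := by
    filter_upwards [h₁, h₂, condDensity_mul hμ hf a b A, condDensity_mul hμ hg a b A]
      with x h1 h2 h3 h4
    rw [← h3, ← h4, h1, h2]
  have hcross : ∀ᵐ x ∂Measure.pi μ,
      marginalDensity μ g A x * marginalDensity μ f (insert a (insert b A)) x =
      marginalDensity μ f A x * marginalDensity μ g (insert a (insert b A)) x := by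
    filter_upwards [hratio, marginalDensity_ne_top hf A, marginalDensity_ne_top hg A]
      with x h1 h2 h3
    rw [ENNReal.div_eq_div_iff (marginalDensity_ne_zero hμ hg _ x) h3
      (marginalDensity_ne_zero hμ hf _ x) h2] at h1
    rw [Finset.insert_comm a b, h1]
  have hA : ∀ h : (∀ i, X i) → ℝ≥0∞, ∀ x y : ∀ i, X i, (∀ i ∉ ({a} : Finset (Fin p)), x i = y i) →
      marginalDensity μ h A x = marginalDensity μ h A y := fun h x y hxy =>
    marginalDensity_congr h A fun i hi => hxy i fun hia => ha (Finset.mem_singleton.1 hia ▸ hi)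
  have haA : a ∉ insert b A := by simp [hab, ha]
  -- Both joint conditionals of (a, b) given A agree. Integrating out a from the cross-multiplied
  -- identity leaves the conditional of b, since the marginals on A do not depend on a; dividing by
  -- it then gives the conditional of a given b and A.
  have hb : ∀ᵐ x ∂Measure.pi μ, condDensity μ f b A x = condDensity μ g b A x := by
    filter_upwards [lmarginal_congr_ae {a} hcross, marginalDensity_ne_top hf A,
      marginalDensity_ne_top hg A] with x h1 h2 h3
    rw [lmarginal_mul_left (hmeas _ hf.1) (hA g), lmarginal_mul_left (hmeas _ hg.1) (hA f),
      ← marginalDensity_eq_lmarginal hf.1 haA, ← marginalDensity_eq_lmarginal hg.1 haA] at h1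
    refine (ENNReal.div_eq_div_iff (marginalDensity_ne_zero hμ hg _ x) h3
      (marginalDensity_ne_zero hμ hf _ x) h2).2 ?_
    exact h1
  refine ⟨hb, ?_⟩
  filter_upwards [hb, hratio, condDensity_mul hμ hf b a A, condDensity_mul hμ hg b a A,
    marginalDensity_ne_top hf A, marginalDensity_ne_top hf (insert b A)] with x h1 h2 h3 h4 h5 h6
  rw [Finset.insert_comm a b, h2, Finset.insert_comm b a, ← h4, ← h1] at h3
  refine (ENNReal.mul_right_inj ?_ ?_).1 h3
  · exact ENNReal.div_ne_zero.2 ⟨marginalDensity_ne_zero hμ hf _ x, h5⟩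
  · exact ENNReal.div_ne_top h6 (marginalDensity_ne_zero hμ hf _ x)

end Conditional

/-! ### Invariance of the model under covered reversals -/

section Flip

open EGraph

variable {p : ℕ}

theorem EGraph.IsDAG.mem_parents {D : EGraph (Fin p)} (hD : D.IsDAG) {a b : Fin p} :
    b ∈ D.parents a ↔ D.E b a := by simp [parents, hD.arrow_iff]

theorem EGraph.IsDAG.intervene {D : EGraph (Fin p)} (hD : D.IsDAG) (I : Finset (Fin p)) :
    (D.intervene I).IsDAG :=
  isDAG_of_acyclic fun a ha => hD.2 a (Relation.TransGen.mono (fun _ _ h => h.1) _ _ ha)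

theorem EGraph.IsDAG.parents_intervene {D : EGraph (Fin p)} (hD : D.IsDAG) (I : Finset (Fin p))
    (a : Fin p) : (D.intervene I).parents a = if a ∈ I then ∅ else D.parents a := by
  ext b
  rw [(hD.intervene I).mem_parents]
  by_cases ha : a ∈ I <;> simp [ha, EGraph.intervene, hD.mem_parents]

variable {X : Fin p → Type*} [∀ i, MeasurableSpace (X i)] {μ : ∀ i, Measure (X i)}
  [∀ i, SigmaFinite (μ i)] {ι : Type*} {𝓘 : ι → Finset (Fin p)}

/-- Reversing a covered edge that no target separates preserves the interventional model. -/
theorem interventionDensities_subset_flip (hμ : ∀ i, μ i ≠ 0) {D : EGraph (Fin p)} {x y : Fin p}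
    (hxy : D.E x y) (hD : D.IsDAG) (hc : D.IsCovered x y) (hI : ∀ j, x ∈ 𝓘 j ↔ y ∈ 𝓘 j) :
    interventionDensities μ 𝓘 D ⊆ interventionDensities μ 𝓘 (D.flip x y hxy) := by
  have hF := hD.flip hxy hc
  have hne : x ≠ y := E.ne hxy
  have hpy : D.parents y = insert x (D.parents x) := by
    ext z
    rw [Finset.mem_insert, hD.mem_parents, hD.mem_parents]
    by_cases hz : z = x
    · simp [hz, hxy]
    · simp [hz, hc z hz]
  have hpx' : (D.flip x y hxy).parents x = insert y (D.parents x) := by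
    ext z
    rw [Finset.mem_insert, hD.mem_parents, hF.mem_parents]
    simp [EGraph.flip, hne, or_comm]
  have hpy' : (D.flip x y hxy).parents y = D.parents x := by
    ext z
    rw [hD.mem_parents, hF.mem_parents]
    by_cases hz : z = x
    · simp [hz, EGraph.flip, hne, hne.symm, D.irrefl]
    · simp [hz, EGraph.flip, hne.symm, hc z hz]
  have hp : ∀ i, i ≠ x → i ≠ y → (D.flip x y hxy).parents i = D.parents i := by
    intro i hix hiy
    ext z
    rw [hD.mem_parents, hF.mem_parents]
    simp [EGraph.flip, hix, hiy]
  rintro F ⟨hM, hE⟩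
  refine ⟨fun j => ⟨(hM j).1, ?_⟩, fun j k a ha => ?_⟩
  · have hprod : ∀ᵐ z ∂Measure.pi μ,
        ∏ i, condDensity μ (F j) i ((D.intervene (𝓘 j)).parents i) z =
        ∏ i, condDensity μ (F j) i (((D.flip x y hxy).intervene (𝓘 j)).parents i) z := by
      filter_upwards [condDensity_mul_comm hμ (hM j).1 x y (D.parents x)] with z hz
      simp only [hD.parents_intervene, hF.parents_intervene]
      have hy : y ∈ Finset.univ.erase x := by simp [hne.symm]
      rw [← Finset.mul_prod_erase _ _ (Finset.mem_univ x), ← Finset.mul_prod_erase _ _ hy,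
        ← Finset.mul_prod_erase Finset.univ _ (Finset.mem_univ x),
        ← Finset.mul_prod_erase _ (fun i => condDensity μ (F j) i (if i ∈ 𝓘 j then ∅ else
          (D.flip x y hxy).parents i) z) hy, ← mul_assoc, ← mul_assoc]
      congr 1
      · by_cases hx : x ∈ 𝓘 j
        · simp [hx, (hI j).1 hx]
        · have hy : y ∉ 𝓘 j := fun h => hx ((hI j).2 h)
          simp only [hx, hy, if_false, hpy, hpx', hpy']
          rw [hz, mul_comm]
      · refine Finset.prod_congr rfl fun i hi => ?_
        simp only [Finset.mem_erase] at hi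
        rw [hp i hi.2.1 hi.1]
    filter_upwards [(hM j).2, hprod] with z h1 h2
    rw [h1, h2]
  · have hswap : x ∉ 𝓘 j ∪ 𝓘 k → y ∉ 𝓘 j ∪ 𝓘 k → _ := fun h1 h2 =>
      condDensity_swap hμ (hM j).1 (hM k).1 hne (fun h => D.irrefl x (hD.mem_parents.1 h))
        (hE j k x h1) (hpy ▸ hE j k y h2)
    have hiff : x ∈ 𝓘 j ∪ 𝓘 k ↔ y ∈ 𝓘 j ∪ 𝓘 k := by simp [hI]
    by_cases hax : a = x
    · subst hax
      rw [hpx']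
      exact (hswap ha fun h => ha (hiff.2 h)).2
    · by_cases hay : a = y
      · subst hay
        rw [hpy']
        exact (hswap (fun h => ha (hiff.1 h)) ha).1
      · rw [hp a hax hay]
        exact hE j k a ha

theorem EGraph.StructEquiv.interventionDensities_subset (hμ : ∀ i, μ i ≠ 0)
    {D₁ D₂ : EGraph (Fin p)} (h : StructEquiv 𝓘 D₁ D₂) (h₁ : D₁.IsDAG) (h₂ : D₂.IsDAG) :
    interventionDensities μ 𝓘 D₁ ⊆ interventionDensities μ 𝓘 D₂ :=
  StructEquiv.induction_flip
    (R := fun D₁ D₂ => interventionDensities μ 𝓘 D₁ ⊆ interventionDensities μ 𝓘 D₂)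
    (fun _ => subset_rfl) (fun _ _ _ => subset_trans)
    (fun _ _ _ hxy hD hc hI => interventionDensities_subset_flip hμ hxy hD hc hI) h h₁ h₂

theorem EGraph.StructEquiv.markovEquivalent (hμ : ∀ i, μ i ≠ 0)
    {D₁ D₂ : EGraph (Fin p)} (h : StructEquiv 𝓘 D₁ D₂) (h₁ : D₁.IsDAG) (h₂ : D₂.IsDAG) :
    MarkovEquivalent μ 𝓘 D₁ D₂ :=
  (h.interventionDensities_subset hμ h₁ h₂).antisymm (h.symm.interventionDensities_subset hμ h₂ h₁)

end Flip

/-! ### One-dimensional base densities -/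

section Base

/-- A positive probability density `h` together with a bounded function `w` without zeros that is
centered with respect to `h`. -/
structure BaseDensity {α : Type*} [MeasurableSpace α] (μ : Measure α) where
  h : α → ℝ≥0∞
  w : α → ℝ
  measurable_h : Measurable h
  measurable_w : Measurable w
  h_pos : ∀ x, 0 < h x
  h_lt_top : ∀ x, h x < ∞
  w_ne_zero : ∀ x, w x ≠ 0
  abs_w_le : ∀ x, |w x| ≤ 1
  lintegral_perturb : ∀ c : ℝ, |c| ≤ 1 → ∫⁻ x, h x * ENNReal.ofReal (1 + c * w x) ∂μ = 1

theorem BaseDensity.lintegral_h {α : Type*} [MeasurableSpace α] {μ : Measure α}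
    (B : BaseDensity μ) : ∫⁻ x, B.h x ∂μ = 1 := by
  simpa using B.lintegral_perturb 0 (by simp)

theorem one_add_mul_nonneg {a b : ℝ} (ha : |a| ≤ 1) (hb : |b| ≤ 1) : 0 ≤ 1 + a * b := by
  have h := mul_le_one₀ ha (abs_nonneg b) hb
  rw [← abs_mul] at h
  linarith [neg_abs_le (a * b)]

/-- Normalize a positive integrable function to h and let q be the probability of s under h. The
function 1_s − q is centered, and has no zeros because 0 < q < 1; the set t disjoint from s ensures
q < 1. -/
theorem exists_baseDensity {α : Type*} [MeasurableSpace α] (μ : Measure α) [SigmaFinite μ]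
    (hμ : ∃ s t : Set α, MeasurableSet s ∧ MeasurableSet t ∧ Disjoint s t ∧ 0 < μ s ∧ 0 < μ t) :
    Nonempty (BaseDensity μ) := by
  obtain ⟨s, t, hs, ht, hst, hμs, hμt⟩ := hμ
  obtain ⟨g, hg, hgm, hgi⟩ := exists_pos_lintegral_lt_of_sigmaFinite μ one_ne_zero
  let m := ∫⁻ x, (g x : ℝ≥0∞) ∂μ
  have hgm' : Measurable fun x => (g x : ℝ≥0∞) := hgm.coe_nnreal_ennreal
  have hm0 : m ≠ 0 := by
    refine ((lintegral_pos_iff_support hgm').2 (hμs.trans_le (measure_mono fun x _ => ?_))).ne'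
    simpa using (hg x).ne'
  have hmt : m ≠ ∞ := (hgi.trans ENNReal.one_lt_top).ne
  let h : α → ℝ≥0∞ := fun x => g x / m
  have hh : Measurable h := hgm'.div_const m
  have hpos : ∀ x, 0 < h x := fun x =>
    ENNReal.div_pos (by simpa using (hg x).ne') hmt
  have hint : ∫⁻ x, h x ∂μ = 1 := by
    simp only [h, div_eq_mul_inv]
    rw [lintegral_mul_const _ hgm']
    exact ENNReal.mul_inv_cancel hm0 hmt
  let ν := μ.withDensity h
  have hν : IsProbabilityMeasure ν := ⟨by simp [ν, hint]⟩
  have hνpos : ∀ u, MeasurableSet u → 0 < μ u → 0 < ν u := by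
    intro u hu hμu
    refine pos_iff_ne_zero.2 fun h0 => hμu.ne' ?_
    rw [withDensity_apply_eq_zero hh] at h0
    refine measure_mono_null (t := {x | h x ≠ 0} ∩ u) (fun x hx => ⟨(hpos x).ne', hx⟩) h0
  let q := ν.real s
  have hq0 : 0 < q := ENNReal.toReal_pos (hνpos s hs hμs).ne' (measure_ne_top _ _)
  have hq1 : q < 1 := by
    have h1 : 0 < ν.real t := ENNReal.toReal_pos (hνpos t ht hμt).ne' (measure_ne_top _ _)
    have h2 : ν.real (s ∪ t) = q + ν.real t := measureReal_union hst ht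
    have h3 : ν.real (s ∪ t) ≤ 1 := measureReal_le_one
    linarith
  let w : α → ℝ := fun x => s.indicator 1 x - q
  have hw : Measurable w := (measurable_one.indicator hs).sub_const q
  have hwx : ∀ x, w x = 1 - q ∨ w x = -q := by
    intro x
    by_cases hx : x ∈ s <;> simp [w, hx]
  have hle : ∀ x, |w x| ≤ 1 := by
    intro x
    rw [abs_le]
    rcases hwx x with h | h <;> rw [h] <;> constructor <;> linarith
  refine ⟨⟨h, w, hh, hw, hpos, fun x => ENNReal.div_lt_top ENNReal.coe_ne_top hm0, ?_, hle, ?_⟩⟩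
  · intro x
    rcases hwx x with h | h <;> rw [h]
    · linarith
    · linarith
  · intro c hc
    have hm : Measurable fun x => ENNReal.ofReal (1 + c * w x) :=
      (measurable_const.add (hw.const_mul c)).ennreal_ofReal
    have hwi : Integrable w ν := .of_bound hw.aestronglyMeasurable 1 (.of_forall hle)
    have hw0 : ∫ x, w x ∂ν = 0 := by
      have hi : Integrable (s.indicator (1 : α → ℝ)) ν := (integrable_const 1).indicator hs
      simp only [w]
      rw [integral_sub hi (integrable_const q), integral_indicator_one hs]
      simp [q]
    have h1 := lintegral_withDensity_eq_lintegral_mul μ hh hm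
    simp only [Pi.mul_apply] at h1
    have hi : Integrable (fun x => 1 + c * w x) ν := (integrable_const 1).add (hwi.const_mul c)
    have h2 : ∫ x, 1 + c * w x ∂ν = 1 := by
      rw [integral_add (integrable_const 1) (hwi.const_mul c), integral_const_mul, hw0]
      simp
    rw [← h1, ← ofReal_integral_eq_lintegral_ofReal hi
      (.of_forall fun x => one_add_mul_nonneg hc (hle x)), h2, ENNReal.ofReal_one]

end Base

/-! ### Perturbed product densities -/

section Perturbation

variable {p : ℕ} {X : Fin p → Type*} [∀ i, MeasurableSpace (X i)] {μ : ∀ i, Measure (X i)}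

/-- The product of the base densities of the coordinates in `A`. -/
noncomputable def baseProd (B : ∀ i, BaseDensity (μ i)) (A : Finset (Fin p)) (x : ∀ i, X i) :
    ℝ≥0∞ := ∏ i ∈ A, (B i).h (x i)

/-- The factor `1 + c ∏_{i ∈ S} wᵢ(xᵢ)` if `S ⊆ A`, and `1` otherwise. -/
noncomputable def perturbation (B : ∀ i, BaseDensity (μ i)) (c : ℝ) (S A : Finset (Fin p))
    (x : ∀ i, X i) : ℝ≥0∞ :=
  if S ⊆ A then ENNReal.ofReal (1 + c * ∏ i ∈ S, (B i).w (x i)) else 1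

/-- The density `∏ᵢ hᵢ(xᵢ) (1 + c ∏_{i ∈ S} wᵢ(xᵢ))`, under which the coordinates in `S` are
dependent, while those in any proper subset of `S` are independent. -/
noncomputable def perturbedDensity (B : ∀ i, BaseDensity (μ i)) (c : ℝ) (S : Finset (Fin p))
    (x : ∀ i, X i) : ℝ≥0∞ :=
  baseProd B Finset.univ x * perturbation B c S Finset.univ x

variable {B : ∀ i, BaseDensity (μ i)} {c : ℝ} {S A : Finset (Fin p)}

theorem baseProd_ne_zero (x : ∀ i, X i) : baseProd B A x ≠ 0 :=
  Finset.prod_ne_zero_iff.2 fun i _ => ((B i).h_pos _).ne'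

theorem baseProd_ne_top (x : ∀ i, X i) : baseProd B A x ≠ ∞ :=
  ENNReal.prod_ne_top fun i _ => ((B i).h_lt_top _).ne

theorem abs_prod_w_le (x : ∀ i, X i) : |∏ i ∈ S, (B i).w (x i)| ≤ 1 := by
  rw [Finset.abs_prod]
  exact Finset.prod_le_one (fun i _ => abs_nonneg _) fun i _ => (B i).abs_w_le _

theorem perturbation_ne_zero (hc : |c| < 1) (x : ∀ i, X i) : perturbation B c S A x ≠ 0 := by
  unfold perturbation
  split_ifs
  · have h := mul_le_mul_of_nonneg_left (abs_prod_w_le (B := B) (S := S) x) (abs_nonneg c)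
    rw [← abs_mul] at h
    refine (ENNReal.ofReal_pos.2 ?_).ne'
    linarith [neg_abs_le (c * ∏ i ∈ S, (B i).w (x i))]
  · exact one_ne_zero

theorem perturbation_ne_top (x : ∀ i, X i) : perturbation B c S A x ≠ ∞ := by
  unfold perturbation
  split_ifs
  · exact ENNReal.ofReal_ne_top
  · exact ENNReal.one_ne_top

@[simp] theorem perturbation_zero (x : ∀ i, X i) : perturbation B 0 S A x = 1 := by
  simp [perturbation]

theorem measurable_perturbedDensity : Measurable (perturbedDensity B c S) := by
  have h1 : Measurable (baseProd B Finset.univ) :=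
    Finset.measurable_fun_prod _ fun i _ => (B i).measurable_h.comp (measurable_pi_apply i)
  have h2 : Measurable fun x : ∀ i, X i => ∏ i ∈ S, (B i).w (x i) :=
    Finset.measurable_fun_prod _ fun i _ => (B i).measurable_w.comp (measurable_pi_apply i)
  refine h1.mul ?_
  change Measurable fun x => if S ⊆ Finset.univ then _ else _
  simp only [Finset.subset_univ, if_true]
  exact (measurable_const.add (h2.const_mul c)).ennreal_ofReal

variable [∀ i, SigmaFinite (μ i)]

/-- Coordinates are integrated out one at a time. A coordinate outside S contributes ∫ h = 1, while
the first one in S erases the perturbation because w is centered. -/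
theorem marginalDensity_perturbedDensity (hc : |c| ≤ 1) (A : Finset (Fin p)) (x : ∀ i, X i) :
    marginalDensity μ (perturbedDensity B c S) A x = baseProd B A x * perturbation B c S A x := by
  have key : ∀ C : Finset (Fin p), ∀ x, lmarginal μ C (perturbedDensity B c S) x =
      baseProd B Cᶜ x * perturbation B c S Cᶜ x := by
    intro C
    induction C using Finset.induction with
    | empty => intro x; simp [perturbedDensity]
    | insert a C ha ih =>
      intro x
      rw [lmarginal_insert _ measurable_perturbedDensity ha]
      simp only [ih]
      have hC : Cᶜ = insert a (insert a C)ᶜ := by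
        ext i
        by_cases hi : i = a <;> simp [hi, ha]
      have ha' : a ∉ (insert a C)ᶜ := by simp
      generalize (insert a C)ᶜ = A at hC ha'
      rw [hC]
      have hprod : ∀ t, baseProd B (insert a A) (Function.update x a t) =
          baseProd B A x * (B a).h t := by
        intro t
        rw [baseProd, Finset.prod_insert ha', Function.update_self, mul_comm]
        congr 1
        refine Finset.prod_congr rfl fun i hi => ?_
        rw [Function.update_of_ne (ne_of_mem_of_not_mem hi ha')]
      simp only [hprod, mul_assoc]
      have hcongr : ∀ (T : Finset (Fin p)), a ∉ T → ∀ t,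
          ∏ i ∈ T, (B i).w (Function.update x a t i) = ∏ i ∈ T, (B i).w (x i) := by
        intro T hT t
        refine Finset.prod_congr rfl fun i hi => ?_
        rw [Function.update_of_ne (ne_of_mem_of_not_mem hi hT)]
      rw [lintegral_const_mul' _ _ (baseProd_ne_top x)]
      congr 1
      by_cases haS : a ∈ S
      · have hSA : ¬ S ⊆ A := fun h => ha' (h haS)
        simp only [perturbation, hSA, if_false]
        by_cases hS : S ⊆ insert a A
        · simp only [hS, if_true]
          -- The other factors form a constant of absolute value at most 1, so `lintegral_perturb`
          -- applies.
          have : ∀ t, c * ∏ i ∈ S, (B i).w (Function.update x a t i) =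
              (c * ∏ i ∈ S.erase a, (B i).w (x i)) * (B a).w t := by
            intro t
            rw [← Finset.mul_prod_erase _ _ haS, hcongr _ (Finset.notMem_erase a S),
              Function.update_self]
            ring
          simp only [this]
          refine (B a).lintegral_perturb _ ?_
          rw [abs_mul]
          exact mul_le_one₀ hc (abs_nonneg _) (abs_prod_w_le x)
        · simp [hS, (B a).lintegral_h]
      · have hiff : S ⊆ insert a A ↔ S ⊆ A := Finset.subset_insert_iff_of_notMem haS
        simp only [perturbation, hiff, hcongr S haS]
        rw [lintegral_mul_const _ (B a).measurable_h, (B a).lintegral_h, one_mul]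
  have := key Aᶜ x
  rwa [compl_compl] at this

theorem perturbedDensity_mem_posDensities (hc : |c| < 1) (hS : S.Nonempty) :
    perturbedDensity B c S ∈ posDensities μ := by
  refine ⟨measurable_perturbedDensity, fun x => ⟨pos_iff_ne_zero.2 ?_, lt_top_iff_ne_top.2 ?_⟩, ?_⟩
  · exact mul_ne_zero (baseProd_ne_zero x) (perturbation_ne_zero hc x)
  · exact ENNReal.mul_ne_top (baseProd_ne_top x) (perturbation_ne_top x)
  · have hne : ∀ i, Nonempty (X i) := fun i => by
      by_contra h
      rw [not_nonempty_iff] at h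
      have := (B i).lintegral_h
      rw [lintegral_of_isEmpty] at this
      exact zero_ne_one this
    let x : ∀ i, X i := fun i => Classical.arbitrary _
    have h := marginalDensity_perturbedDensity (B := B) (S := S) hc.le ∅ x
    rw [marginalDensity, Finset.compl_empty, lmarginal_univ] at h
    refine h.trans ?_
    simp [baseProd, perturbation, hS.ne_empty]

theorem condDensity_perturbedDensity (hc : |c| < 1) {a : Fin p} (ha : a ∉ A) (x : ∀ i, X i) :
    condDensity μ (perturbedDensity B c S) a A x =
      (B a).h (x a) * (perturbation B c S (insert a A) x / perturbation B c S A x) := by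
  rw [condDensity, marginalDensity_perturbedDensity hc.le, marginalDensity_perturbedDensity hc.le,
    show baseProd B (insert a A) x = (B a).h (x a) * baseProd B A x from Finset.prod_insert ha,
    mul_comm ((B a).h (x a)), mul_assoc,
    ENNReal.mul_div_mul_left _ _ (baseProd_ne_zero x) (baseProd_ne_top x), mul_div_assoc]

theorem condDensity_perturbedDensity_of_not_subset (hc : |c| < 1) {a : Fin p} (ha : a ∉ A)
    (hS : a ∈ S → ¬ S ⊆ insert a A) (x : ∀ i, X i) :
    condDensity μ (perturbedDensity B c S) a A x = (B a).h (x a) := by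
  rw [condDensity_perturbedDensity hc ha]
  have h : perturbation B c S (insert a A) x = perturbation B c S A x := by
    by_cases haS : a ∈ S
    · have hA : ¬ S ⊆ A := fun h => hS haS (h.trans (Finset.subset_insert a A))
      simp [perturbation, hS haS, hA]
    · simp only [perturbation, Finset.subset_insert_iff_of_notMem haS]
  rw [h, ENNReal.div_self (perturbation_ne_zero hc x) (perturbation_ne_top x), mul_one]

open EGraph

/-- A model that contains the perturbed density has a vertex of `S` whose parents include all other
vertices of `S`. -/
theorem exists_subset_parents_of_mem_markovDensities (hc : |c| < 1) (hc0 : c ≠ 0)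
    (hμ : ∀ i, μ i ≠ 0) {D : EGraph (Fin p)}
    (h : perturbedDensity B c S ∈ markovDensities μ D) :
    ∃ i ∈ S, S ⊆ insert i (D.parents i) := by
  by_contra! hn
  have hne : Measure.pi μ ≠ 0 := by
    rw [← Measure.measure_univ_ne_zero, Measure.pi_univ, Finset.prod_ne_zero_iff]
    exact fun i _ => by simpa using hμ i
  have : NeZero (Measure.pi μ) := ⟨hne⟩
  -- If no such vertex existed, every conditional density would be the base one and the perturbation
  -- would equal 1 almost everywhere. One point suffices for a contradiction, since w has no zeros.
  obtain ⟨x, hx⟩ := h.2.exists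
  have hself : ∀ i, i ∉ D.parents i := fun i hi => by
    simp only [parents, Finset.mem_filter] at hi
    exact D.irrefl i hi.2.1
  simp only [condDensity_perturbedDensity_of_not_subset hc (hself _) (hn _)] at hx
  have h1 : perturbation B c S Finset.univ x = 1 :=
    (ENNReal.mul_right_inj (baseProd_ne_zero x) (baseProd_ne_top x)).1 (hx.trans (mul_one _).symm)
  simp only [perturbation, Finset.subset_univ, if_true, ENNReal.ofReal_eq_one] at h1
  have h2 : c * ∏ i ∈ S, (B i).w (x i) = 0 := by linarith
  exact mul_ne_zero hc0 (Finset.prod_ne_zero_iff.2 fun i _ => (B i).w_ne_zero _) h2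

variable {ι : Type*} {𝓘 : ι → Finset (Fin p)}

/-- Only the conditional density of b sees the dependence: every vertex of T is a parent of b, so b
is not among its parents. The perturbation is switched off when b is a target, because b must then
be independent of its former parents; the targets missing b share the same c. -/
theorem perturbedDensity_mem_interventionDensities {D : EGraph (Fin p)} (hD : D.IsDAG)
    (hc : |c| < 1) {b : Fin p} {T : Finset (Fin p)} (hT : T ⊆ D.parents b) :
    (fun j => perturbedDensity B (if b ∈ 𝓘 j then 0 else c) (insert b T)) ∈
      interventionDensities μ 𝓘 D := by
  have hcj : ∀ j, |if b ∈ 𝓘 j then 0 else c| < 1 := fun j => by split_ifs <;> simp [hc]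
  have hbT : ∀ {A}, b ∉ A → ¬ insert b T ⊆ A := fun hb h => hb (h (Finset.mem_insert_self b T))
  have hself : ∀ {D' : EGraph (Fin p)}, D'.IsDAG → ∀ i, i ∉ D'.parents i := fun hD' i hi =>
    EGraph.irrefl _ i (hD'.mem_parents.1 hi)
  have hother : ∀ {i}, i ≠ b → ∀ {A}, A ⊆ D.parents i → i ∈ insert b T →
      ¬ insert b T ⊆ insert i A := by
    intro i hib A hA hi
    refine hbT fun hb => ?_
    have hib' := hD.mem_parents.1 (hT ((Finset.mem_insert.1 hi).resolve_left hib))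
    have hbi := hD.mem_parents.1 (hA ((Finset.mem_insert.1 hb).resolve_left hib.symm))
    exact hD.asymm hib' hbi
  refine ⟨fun j => ⟨perturbedDensity_mem_posDensities (hcj j) (Finset.insert_nonempty b T),
    .of_forall fun x => ?_⟩, fun j k a ha => .of_forall fun x => ?_⟩
  · have hcond : ∀ i, condDensity μ (perturbedDensity B (if b ∈ 𝓘 j then 0 else c) (insert b T)) i
        ((D.intervene (𝓘 j)).parents i) x = (B i).h (x i) * if i = b then
          perturbation B (if b ∈ 𝓘 j then 0 else c) (insert b T) Finset.univ x else 1 := by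
      intro i
      have hsub : (D.intervene (𝓘 j)).parents i ⊆ D.parents i := by
        rw [hD.parents_intervene]
        split_ifs <;> simp
      have hi := hself (hD.intervene (𝓘 j)) i
      by_cases hib : i = b
      · subst hib
        rw [condDensity_perturbedDensity (hcj j) hi, if_pos rfl]
        by_cases hij : i ∈ 𝓘 j
        · simp [hij]
        · rw [hD.parents_intervene, if_neg hij] at hi ⊢
          simp [hij, perturbation, hbT hi, Finset.insert_subset_insert i hT]
      · rw [if_neg hib, mul_one, condDensity_perturbedDensity_of_not_subset (hcj j) hi
          (hother hib hsub)]
    simp only [hcond]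
    rw [Finset.prod_mul_distrib, Finset.prod_ite_eq' Finset.univ b, if_pos (Finset.mem_univ b)]
    rfl
  · by_cases hab : a = b
    · subst hab
      simp only [Finset.mem_union, not_or] at ha
      simp [ha.1, ha.2]
    · rw [condDensity_perturbedDensity_of_not_subset (hcj j) (hself hD a) (hother hab subset_rfl),
        condDensity_perturbedDensity_of_not_subset (hcj k) (hself hD a) (hother hab subset_rfl)]

end Perturbation

/-! ### Recovering skeleton and forced edges from the model -/

section Identification

open EGraph

variable {p : ℕ} {X : Fin p → Type*} [∀ i, MeasurableSpace (X i)] {μ : ∀ i, Measure (X i)}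
  [∀ i, SigmaFinite (μ i)] {ι : Type*} {𝓘 : ι → Finset (Fin p)} {D₁ D₂ : EGraph (Fin p)}

theorem exists_subset_parents_of_interventionDensities_subset (hμ : ∀ i, μ i ≠ 0)
    (B : ∀ i, BaseDensity (μ i)) (h₁ : D₁.IsDAG)
    (h : interventionDensities μ 𝓘 D₁ ⊆ interventionDensities μ 𝓘 D₂) {b : Fin p}
    {T : Finset (Fin p)} (hT : ∀ a ∈ T, D₁.E a b) {j : ι} (hb : b ∉ 𝓘 j) :
    ∃ i ∈ insert b T, insert b T ⊆ insert i ((D₂.intervene (𝓘 j)).parents i) := by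
  have hc : |(1 / 2 : ℝ)| < 1 := by norm_num [abs_of_pos]
  have hmem := (h (perturbedDensity_mem_interventionDensities (B := B) (𝓘 := 𝓘) h₁ hc
    fun a ha => h₁.mem_parents.2 (hT a ha))).1 j
  simp only [hb, if_false] at hmem
  exact exists_subset_parents_of_mem_markovDensities hc (by norm_num) hμ hmem

/-- The surviving edge matters, not just adjacency in `D₂`: it detects the direction of edges
separated by a target. -/
theorem adj_intervene_of_interventionDensities_subset (hμ : ∀ i, μ i ≠ 0)
    (B : ∀ i, BaseDensity (μ i)) (h₁ : D₁.IsDAG) (h₂ : D₂.IsDAG)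
    (h : interventionDensities μ 𝓘 D₁ ⊆ interventionDensities μ 𝓘 D₂) {a b : Fin p}
    (hab : D₁.E a b) {j : ι} (hb : b ∉ 𝓘 j) : (D₂.intervene (𝓘 j)).Adj a b := by
  have hne := E.ne hab
  obtain ⟨i, hi, hsub⟩ := exists_subset_parents_of_interventionDensities_subset hμ B h₁ h
    (T := {a}) (by simpa using hab) hb
  simp only [Finset.mem_insert, Finset.mem_singleton] at hi
  rcases hi with rfl | rfl
  · have ha := hsub (show a ∈ insert i {a} by simp)
    exact Or.inl ((h₂.intervene _).mem_parents.1 ((Finset.mem_insert.1 ha).resolve_left hne))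
  · have hb := hsub (Finset.mem_insert_self b {i})
    exact Or.inr ((h₂.intervene _).mem_parents.1 ((Finset.mem_insert.1 hb).resolve_left hne.symm))

theorem adj_iff_of_markovEquivalent (hμ : ∀ i, μ i ≠ 0) (B : ∀ i, BaseDensity (μ i))
    (h𝓘 : IsConservative 𝓘) (h₁ : D₁.IsDAG) (h₂ : D₂.IsDAG) (h : MarkovEquivalent μ 𝓘 D₁ D₂)
    (a b : Fin p) : D₁.Adj a b ↔ D₂.Adj a b := by
  have key : ∀ {D₁ D₂ : EGraph (Fin p)}, D₁.IsDAG → D₂.IsDAG →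
      interventionDensities μ 𝓘 D₁ ⊆ interventionDensities μ 𝓘 D₂ → ∀ {a b}, D₁.E a b →
      D₂.Adj a b := by
    intro D₁ D₂ h₁ h₂ h a b hab
    obtain ⟨j, hj⟩ := h𝓘 b
    exact (adj_intervene_of_interventionDensities_subset hμ B h₁ h₂ h hab hj).imp
      (fun h => h.1) fun h => h.1
  exact ⟨fun hab => hab.elim (key h₁ h₂ h.le) fun hba => (key h₁ h₂ h.le hba).symm,
    fun hab => hab.elim (key h₂ h₁ h.ge) fun hba => (key h₂ h₁ h.ge hba).symm⟩

theorem forced_of_markovEquivalent (hμ : ∀ i, μ i ≠ 0) (B : ∀ i, BaseDensity (μ i))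
    (h𝓘 : IsConservative 𝓘) (h₁ : D₁.IsDAG) (h₂ : D₂.IsDAG) (h : MarkovEquivalent μ 𝓘 D₁ D₂)
    {a b : Fin p} (hf : Forced 𝓘 D₁ a b) : Forced 𝓘 D₂ a b := by
  have hadj := adj_iff_of_markovEquivalent hμ B h𝓘 h₁ h₂ h
  obtain ⟨hab, ⟨c, hcb, hac, hn⟩ | ⟨j, hj⟩⟩ := hf
  · obtain ⟨j, hj⟩ := h𝓘 b
    rw [hadj] at hn
    obtain ⟨i, hi, hsub⟩ := exists_subset_parents_of_interventionDensities_subset hμ B h₁ h.le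
      (T := {a, c}) (by simp [hab, hcb]) hj
    have hpa : ∀ u ∈ insert b ({a, c} : Finset (Fin p)), u ≠ i → D₂.E u i := fun u hu hne =>
      ((h₂.intervene _).mem_parents.1 ((Finset.mem_insert.1 (hsub hu)).resolve_left hne)).1
    -- One of a, b, c has the other two as parents in `D₂`. As a and c are not adjacent, it is b.
    simp only [Finset.mem_insert, Finset.mem_singleton] at hi
    rcases hi with rfl | rfl | rfl
    · exact forced_of_collider (hpa a (by simp) (E.ne hab)) (hpa c (by simp) (E.ne hcb)) hac hn
    · exact (hn (Or.inr (hpa c (by simp) hac.symm))).elim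
    · exact (hn (Or.inl (hpa a (by simp) hac))).elim
  · refine ⟨((hadj a b).1 (Or.inl hab)).resolve_right fun hba => ?_, Or.inr ⟨j, hj⟩⟩
    -- Suppose `D₂` has b → a. The target deletes exactly one of the edges a → b in `D₁` and b → a
    -- in `D₂`, so the dependence allowed by the surviving edge is missing from the other model.
    by_cases hb : b ∈ 𝓘 j
    · have ha : a ∉ 𝓘 j := fun ha => hj (iff_of_true ha hb)
      rcases adj_intervene_of_interventionDensities_subset hμ B h₂ h₁ h.ge hba ha with h' | h'
      · exact h₁.asymm hab h'.1
      · exact h'.2 hb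
    · have ha : a ∈ 𝓘 j := by_contra fun ha => hj (iff_of_false ha hb)
      rcases adj_intervene_of_interventionDensities_subset hμ B h₁ h₂ h.le hab hb with h' | h'
      · exact h₂.asymm hba h'.1
      · exact h'.2 ha

theorem markovEquivalent_iff_structEquiv
    (hμ : ∀ i, ∃ s t : Set (X i), MeasurableSet s ∧ MeasurableSet t ∧ Disjoint s t ∧
      0 < μ i s ∧ 0 < μ i t) (h𝓘 : IsConservative 𝓘) (h₁ : D₁.IsDAG) (h₂ : D₂.IsDAG) :
    MarkovEquivalent μ 𝓘 D₁ D₂ ↔ StructEquiv 𝓘 D₁ D₂ := by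
  have hμ0 : ∀ i, μ i ≠ 0 := fun i h0 => by
    obtain ⟨s, -, -, -, -, hs, -⟩ := hμ i
    simp [h0] at hs
  refine ⟨fun h => ?_, fun h => h.markovEquivalent hμ0 h₁ h₂⟩
  let B := fun i => (exists_baseDensity (μ i) (hμ i)).some
  exact ⟨adj_iff_of_markovEquivalent hμ0 B h𝓘 h₁ h₂ h, fun a b =>
    ⟨forced_of_markovEquivalent hμ0 B h𝓘 h₁ h₂ h,
      forced_of_markovEquivalent hμ0 B h𝓘 h₂ h₁ h.symm⟩⟩

end Identification

theorem mainTheorem4 {p : ℕ} {X : Fin p → Type*} [∀ i, MeasurableSpace (X i)]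
    (μ : ∀ i, Measure (X i)) [∀ i, SigmaFinite (μ i)]
    (hμ : ∀ i, ∃ s t : Set (X i), MeasurableSet s ∧ MeasurableSet t ∧ Disjoint s t ∧
      0 < μ i s ∧ 0 < μ i t)
    {ι : Type*} [Finite ι] (𝓘 : ι → Finset (Fin p)) (h𝓘 : IsConservative 𝓘) :
    (∀ D : EGraph (Fin p), D.IsDAG → ∀ D' : EGraph (Fin p), D'.IsDirected →
      ((D'.IsDAG ∧ MarkovEquivalent μ 𝓘 D' D) ↔
        D'.IsPerfectOrientationOf (essentialGraph μ 𝓘 D))) ∧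
    Set.BijOn EGraph.union (markovClasses μ 𝓘) (essentialGraphs μ 𝓘) := by
  have hclass : ∀ {D : EGraph (Fin p)}, D.IsDAG → ∀ D' : EGraph (Fin p),
      (D'.IsDAG ∧ MarkovEquivalent μ 𝓘 D' D ↔ D'.IsDAG ∧ EGraph.StructEquiv 𝓘 D' D) :=
    fun hD D' => and_congr_right fun hD' => markovEquivalent_iff_structEquiv hμ h𝓘 hD' hD
  have hess : ∀ {D : EGraph (Fin p)}, D.IsDAG →
      essentialGraph μ 𝓘 D = EGraph.structEssential 𝓘 D := fun hD =>
    congrArg EGraph.union (Set.ext (hclass hD))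
  have main : ∀ D : EGraph (Fin p), D.IsDAG → ∀ D' : EGraph (Fin p),
      ((D'.IsDAG ∧ MarkovEquivalent μ 𝓘 D' D) ↔
        D'.IsPerfectOrientationOf (essentialGraph μ 𝓘 D)) := by
    intro D hD D'
    rw [hclass hD, hess hD]
    exact ⟨fun h => hD.isPerfectOrientationOf h.1 h.2, fun h => h.isDAG_and_structEquiv hD⟩
  refine ⟨fun D hD D' _ => main D hD D', ?_, ?_, ?_⟩
  · rintro C ⟨D, hD, rfl⟩
    exact ⟨D, hD, rfl⟩
  -- By (i) the members of a class are exactly the perfect orientations of its essential graph, so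
  -- equal unions force equal classes.
  · rintro C₁ ⟨D₁, h₁, rfl⟩ C₂ ⟨D₂, h₂, rfl⟩ h
    ext D'
    have h' : essentialGraph μ 𝓘 D₁ = essentialGraph μ 𝓘 D₂ := h
    exact (main D₁ h₁ D').trans (h' ▸ (main D₂ h₂ D').symm)
  · rintro G ⟨D, hD, rfl⟩
    exact ⟨markovClass μ 𝓘 D, ⟨D, hD, rfl⟩, rfl⟩
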